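/- **Setting.** Let $\mathcal I$ be a countable set of tasks with a probability distribution $p$, let $f_i:\mathbb R^d\to\mathbb R$ be the loss of task $i$, $f(w)=\mathbb E_{i\sim p}f_i(w)$ (assumed well defined), and for a stepsize $\alpha>0$ let $$F(w)=\mathbb E_{i\sim p}\big[f_i(w-\alpha\nabla f_i(w))\big].$$ Assume: (1) $F$ is bounded below; for the (deterministic) starting point $w_0$ put $\Delta=F(w_0)-\inf F$. (2) Each $f_i$ is twice continuously differentiable and $\|\nabla f_i(w)-\nabla f_i(u)\|\le L\|w-u\|$ for all $i,w,u$, with $L>0$. (3) $\|\nabla^2f_i(w)-\nabla^2f_i(u)\|\le\rho\|w-u\|$ for all $i,w,u$. (4) $\mathbb E_{i\sim p}\|\nabla f(w)-\nabla f_i(w)\|^2\le\sigma^2$ for all $w$, with $\sigma>0$. (5) A data point $\theta$ drawn from the data distribution of task $i$ gives (measurable) unbiased estimates $\nabla f_i(w,\theta)$ of $\nabla f_i(w)$ and $\nabla^2f_i(w,\theta)$ of $\nabla^2f_i(w)$, with $\mathbb E_\theta\|\nabla f_i(w,\theta)-\nabla f_i(w)\|^2\le\tilde\sigma^2$ and $\mathbb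 E_\theta\|\nabla^2f_i(w,\theta)-\nabla^2f_i(w)\|^2\le\sigma_H^2$ for all $i,w$, where $\tilde\sigma,\sigma_H\ge0$. Matrix norms are operator norms. For a dataset $\mathcal D$ write $\tilde\nabla f_i(w,\mathcal D)=\frac1{|\mathcal D|}\sum_{\theta\in\mathcal D}\nabla f_i(w,\theta)$ and $\tilde\nabla^2f_i(w,\mathcal D)=\frac1{|\mathcal D|}\sum_{\theta\in\mathcal D}\nabla^2f_i(w,\theta)$. **Algorithm (MAML).** In iteration $k$ draw i.i.d. tasks $\mathcal B_k$ from $p$, $|\mathcal B_k|=B$, and for each $i\in\mathcal B_k$ independent i.i.d. datasets $\mathcal D^i_{in},\mathcal D^i_o,\mathcal D^i_h$ of sizes $D_{in},D_o,D_h$; independently of these, draw i.i.d. tasks $\mathcal B'_k$ from $p$, $|\mathcal B_k'|=B'$, and for each $j\in\mathcal B'_k$ an i.i.d. dataset $\mathcal D^j_\beta$ of size $D_\beta$; the draws of different iterations are independent. Set $$w_{k+1}=w_k-\frac{\beta_k}{B}\sum_{i\in\mathcal B_k}\big(I-\alpha\tilde\nabla^2f_i(w_k,\mathcal D^i_h)\big)\tilde\nabla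 f_i\big(w_k-\alpha\tilde\nabla f_i(w_k,\mathcal D^i_{in}),\mathcal D^i_o\big),$$ $$\beta_k=\frac{\tilde\beta(w_k)}{12},\qquad \tilde\beta(w_k)=\frac1{4L+\frac{2\rho\alpha}{B'}\sum_{j\in\mathcal B'_k}\|\tilde\nabla f_j(w_k,\mathcal D^j_\beta)\|}.$$ **Theorem.** Let $\alpha\in(0,\frac1{6L}]$, let all batch sizes be positive, and let $B\ge20$, $D_h\ge\lceil2\alpha^2\sigma_H^2\rceil$, $B'\ge\lceil\frac12(\rho\alpha\sigma/L)^2\rceil$, $D_\beta\ge\lceil(2\rho\alpha\tilde\sigma/L)^2\rceil$. Put $s=\frac{\sigma^2}{B}+\frac{\tilde\sigma^2}{BD_o}+\frac{\tilde\sigma^2}{D_{in}}$. (a) (General version.) $F$ is differentiable, and for every $\epsilon>0$ there is a $k$ with $$k\le C\,\Delta\min\Big\{\frac{L+\rho\alpha(\sigma+\epsilon)}{\epsilon^2},\ \frac{LB}{\sigma^2}+\frac{L(BD_o+D_{in})}{\tilde\sigma^2}\Big\}$$ such that $$\mathbb E\|\nabla F(w_k)\|\le\max\Big\{\sqrt{61\Big(1+\frac{\rho\alpha}{L}\sigma\Big)s},\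 \frac{61\rho\alpha}{L}\,s,\ \epsilon\Big\}.$$ Here $C$ is an absolute constant. (b) (Simplified version.) If moreover $\rho\alpha/L\le K$ and $\sigma^2+\tilde\sigma^2\le K$ for a constant $K$, then for every $\epsilon\in(0,1)$ there is a $k$ with $$k\le C\,\Delta\min\Big\{\frac{L}{\epsilon^2},\ \frac{LB}{\sigma^2}+\frac{L(BD_o+D_{in})}{\tilde\sigma^2}\Big\}$$ such that $\mathbb E\|\nabla F(w_k)\|\le C\sqrt s+\epsilon$. Here $C$ depends only on $K$. If $\tilde\sigma=0$, the second term in each minimum is read as $+\infty$. -/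

import Mathlib

open MeasureTheory ProbabilityTheory

universe u v w

noncomputable section

namespace MAML

/-- The parameter space `ℝ^d` with its Euclidean norm. -/
abbrev Vec (d : ℕ) : Type := EuclideanSpace ℝ (Fin d)

/-- The data of a meta-learning problem. Tasks are indexed by `ι` and drawn from `p`; task `i` has
loss `f i` and data distribution `ν i`; a data point `θ` gives a stochastic gradient `g i w θ` and a
stochastic Hessian `H i w θ` of `f i` at `w` (for instance the gradient and the Hessian of a sample
loss `w ↦ ℓ i w θ` whose `ν i`-expectation is `f i`). -/
structure Model (d : ℕ) (ι : Type u) (Θ : Type v) [MeasurableSpace ι] [MeasurableSpace Θ] where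
  p : Measure ι
  f : ι → Vec d → ℝ
  ν : ι → Measure Θ
  g : ι → Vec d → Θ → Vec d
  H : ι → Vec d → Θ → (Vec d →L[ℝ] Vec d)

/-- The constants: inner stepsize `α`, smoothness constant `L` of all the losses, Lipschitz constant
`ρ` of all the Hessians, bound `σ` on the deviation of the task gradients, bounds `σt` and `σH` on
the deviation of the stochastic gradients and Hessians. -/
structure Constants where
  α : ℝ
  L : ℝ
  ρ : ℝ
  σ : ℝ
  σt : ℝ
  σH : ℝ

/-- The batch sizes: `B` tasks per iteration, each with datasets of sizes `Din`, `Do`, `Dh`, and, for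
the stepsize, `B'` tasks, each with a dataset of size `Dβ`. -/
structure BatchSizes where
  B : ℕ
  Din : ℕ
  Do : ℕ
  Dh : ℕ
  B' : ℕ
  Dβ : ℕ

namespace Model

variable {d : ℕ} {ι : Type u} {Θ : Type v} [MeasurableSpace ι] [MeasurableSpace Θ]

/-- The expected loss `f(w) = E_{i ∼ p} f_i(w)`. -/
def meanLoss (M : Model d ι Θ) (w : Vec d) : ℝ := ∫ i, M.f i w ∂M.p

/-- The Hessian `∇² f_i(w)`, as a linear operator. -/
def hess (M : Model d ι Θ) (i : ι) (w : Vec d) : Vec d →L[ℝ] Vec d :=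
  fderiv ℝ (gradient (M.f i)) w

/-- The MAML objective `F(w) = E_{i ∼ p} f_i(w - α ∇f_i(w))`. -/
def F (M : Model d ι Θ) (α : ℝ) (w : Vec d) : ℝ :=
  ∫ i, M.f i (w - α • gradient (M.f i) w) ∂M.p

/-- The optimality gap `Δ = F(w₀) - inf F`. -/
def gap (M : Model d ι Θ) (α : ℝ) (w₀ : Vec d) : ℝ := M.F α w₀ - ⨅ w, M.F α w

/-- The standing assumptions on the problem. Variances are Lebesgue integrals with values in
`[0, ∞]`, so that the bounds on them include their finiteness. -/
structure Assumptions (M : Model d ι Θ) (c : Constants) : Prop where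
  prob_task : IsProbabilityMeasure M.p
  prob_data : ∀ i, IsProbabilityMeasure (M.ν i)
  L_pos : 0 < c.L
  ρ_nonneg : 0 ≤ c.ρ
  σ_pos : 0 < c.σ
  σt_nonneg : 0 ≤ c.σt
  σH_nonneg : 0 ≤ c.σH
  /-- the expected loss is well defined -/
  integrable_loss : ∀ w, Integrable (fun i => M.f i w) M.p
  /-- the objective is bounded below -/
  bddBelow : BddBelow (Set.range (M.F c.α))
  /-- the losses are twice continuously differentiable and `L`-smooth -/
  contDiff : ∀ i, ContDiff ℝ 2 (M.f i)
  smooth : ∀ i w u, ‖gradient (M.f i) w - gradient (M.f i) u‖ ≤ c.L * ‖w - u‖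
  /-- the Hessians are `ρ`-Lipschitz in operator norm -/
  hess_lipschitz : ∀ i w u, ‖M.hess i w - M.hess i u‖ ≤ c.ρ * ‖w - u‖
  /-- the variance over tasks of the gradient is at most `σ²` -/
  task_variance : ∀ w,
    ∫⁻ i, ‖gradient M.meanLoss w - gradient (M.f i) w‖ₑ ^ 2 ∂M.p ≤ ENNReal.ofReal (c.σ ^ 2)
  /-- the stochastic gradients and Hessians are measurable -/
  measurable_g : ∀ i, Measurable (fun x : Vec d × Θ => M.g i x.1 x.2)
  measurable_H : ∀ i, Measurable (fun x : Vec d × Θ => M.H i x.1 x.2)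
  /-- the stochastic gradients and Hessians are unbiased -/
  unbiased_g : ∀ i w, ∫ θ, M.g i w θ ∂M.ν i = gradient (M.f i) w
  unbiased_H : ∀ i w, ∫ θ, M.H i w θ ∂M.ν i = M.hess i w
  /-- the stochastic gradients and Hessians have variance at most `σt²` and `σH²` -/
  variance_g : ∀ i w,
    ∫⁻ θ, ‖M.g i w θ - gradient (M.f i) w‖ₑ ^ 2 ∂M.ν i ≤ ENNReal.ofReal (c.σt ^ 2)
  variance_H : ∀ i w,
    ∫⁻ θ, ‖M.H i w θ - M.hess i w‖ₑ ^ 2 ∂M.ν i ≤ ENNReal.ofReal (c.σH ^ 2)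

/-- The stochastic gradient of task `i` at `w` over a dataset `D`. -/
def batchGrad (M : Model d ι Θ) {m : ℕ} (i : ι) (w : Vec d) (D : Fin m → Θ) : Vec d :=
  (m : ℝ)⁻¹ • ∑ j, M.g i w (D j)

/-- The stochastic Hessian of task `i` at `w` over a dataset `D`. -/
def batchHess (M : Model d ι Θ) {m : ℕ} (i : ι) (w : Vec d) (D : Fin m → Θ) :
    Vec d →L[ℝ] Vec d :=
  (m : ℝ)⁻¹ • ∑ j, M.H i w (D j)

end Model

/-- One task of the update: the task with its datasets `D_in`, `D_o`, `D_h`. -/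
abbrev TaskSample (ι : Type u) (Θ : Type v) (n : BatchSizes) : Type (max u v) :=
  ι × (Fin n.Din → Θ) × (Fin n.Do → Θ) × (Fin n.Dh → Θ)

/-- One task of the stepsize estimate: the task with its dataset `D_β`. -/
abbrev StepSample (ι : Type u) (Θ : Type v) (n : BatchSizes) : Type (max u v) :=
  ι × (Fin n.Dβ → Θ)

/-- Everything that is sampled in one iteration: the batch of tasks for the update, and the batch of
tasks for the stepsize. -/
abbrev Block (ι : Type u) (Θ : Type v) (n : BatchSizes) : Type (max u v) :=
  (Fin n.B → TaskSample ι Θ n) × (Fin n.B' → StepSample ι Θ n)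

/-- The requirements on the batch sizes (all of which are positive). -/
structure BatchSizes.Admissible (n : BatchSizes) (c : Constants) : Prop where
  B_ge : 20 ≤ n.B
  Din_pos : 0 < n.Din
  Do_pos : 0 < n.Do
  Dh_pos : 0 < n.Dh
  B'_pos : 0 < n.B'
  Dβ_pos : 0 < n.Dβ
  Dh_ge : ⌈2 * c.α ^ 2 * c.σH ^ 2⌉₊ ≤ n.Dh
  B'_ge : ⌈(1 / 2 : ℝ) * (c.ρ * c.α * c.σ / c.L) ^ 2⌉₊ ≤ n.B'
  Dβ_ge : ⌈(2 * c.ρ * c.α * c.σt / c.L) ^ 2⌉₊ ≤ n.Dβ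

/-- The quantity `σ²/B + σt²/(B D_o) + σt²/D_in`. -/
def noiseLevel (c : Constants) (n : BatchSizes) : ℝ :=
  c.σ ^ 2 / n.B + c.σt ^ 2 / (n.B * n.Do) + c.σt ^ 2 / n.Din

namespace Model

variable {d : ℕ} {ι : Type u} {Θ : Type v} [MeasurableSpace ι] [MeasurableSpace Θ]

section Law

variable [Countable ι] [DiscreteMeasurableSpace ι]

/-- The law of one task of the update: `i ∼ p` and, given `i`, the data points of the three datasets
are independent with law `ν i`. -/
def taskLaw (M : Model d ι Θ) (n : BatchSizes) : Measure (TaskSample ι Θ n) :=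
  M.p ⊗ₘ (Kernel.ofFunOfCountable fun i =>
    (Measure.pi fun _ : Fin n.Din => M.ν i).prod
      ((Measure.pi fun _ : Fin n.Do => M.ν i).prod (Measure.pi fun _ : Fin n.Dh => M.ν i)))

/-- The law of one task of the stepsize estimate. -/
def stepLaw (M : Model d ι Θ) (n : BatchSizes) : Measure (StepSample ι Θ n) :=
  M.p ⊗ₘ (Kernel.ofFunOfCountable fun i => Measure.pi fun _ : Fin n.Dβ => M.ν i)

/-- The law of the samples of one iteration: all tasks, with their datasets, are independent. -/
def blockLaw (M : Model d ι Θ) (n : BatchSizes) : Measure (Block ι Θ n) :=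
  (Measure.pi fun _ : Fin n.B => M.taskLaw n).prod (Measure.pi fun _ : Fin n.B' => M.stepLaw n)

/-- `ξ k` is what is sampled in iteration `k`: the samples of different iterations are independent,
and each has the law above. -/
structure IsSampling (M : Model d ι Θ) (n : BatchSizes) {Ω : Type w} [MeasurableSpace Ω]
    (P : Measure Ω) (ξ : ℕ → Ω → Block ι Θ n) : Prop where
  law : ∀ k, HasLaw (ξ k) (M.blockLaw n) P
  indep : iIndepFun ξ P

end Law

/-- The smoothness estimate `4 L + (2 ρ α / B') ∑_j ‖∇f_j(w, D_β^j)‖`. -/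
def Ltilde (M : Model d ι Θ) (c : Constants) (n : BatchSizes) (w : Vec d)
    (s : Fin n.B' → StepSample ι Θ n) : ℝ :=
  4 * c.L + 2 * c.ρ * c.α / n.B' * ∑ j, ‖M.batchGrad (s j).1 w (s j).2‖

/-- The random stepsize `β = (1/12) (1 / Ltilde)`. -/
def stepsize (M : Model d ι Θ) (c : Constants) (n : BatchSizes) (w : Vec d)
    (s : Fin n.B' → StepSample ι Θ n) : ℝ :=
  1 / M.Ltilde c n w s / 12

/-- The contribution `(I - α ∇²f_i(w, D_h)) ∇f_i(w - α ∇f_i(w, D_in), D_o)` of one task. -/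
def direction (M : Model d ι Θ) (α : ℝ) (n : BatchSizes) (w : Vec d) :
    TaskSample ι Θ n → Vec d
  | (i, Din, Do, Dh) =>
    (ContinuousLinearMap.id ℝ (Vec d) - α • M.batchHess i w Dh)
      (M.batchGrad i (w - α • M.batchGrad i w Din) Do)

/-- One iteration of MAML. -/
def step (M : Model d ι Θ) (c : Constants) (n : BatchSizes) (w : Vec d) (x : Block ι Θ n) :
    Vec d :=
  w - (M.stepsize c n w x.2 / n.B) • ∑ b, M.direction c.α n w (x.1 b)

/-- The iterates of MAML, started at `w₀` and run on the samples `ξ`. -/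
def iterate (M : Model d ι Θ) (c : Constants) (n : BatchSizes) (w₀ : Vec d) {Ω : Type w}
    (ξ : ℕ → Ω → Block ι Θ n) : ℕ → Ω → Vec d
  | 0, _ => w₀
  | k + 1, ω => M.step c n (M.iterate c n w₀ ξ k ω) (ξ k ω)

end Model

end MAML

end

/-! The argument is stochastic gradient descent for an objective whose smoothness varies from point
to point. Since `α L ≤ 1/6`, each map `w ↦ f_i(w - α ∇f_i(w))` has gradient `(I - α ∇²f_i(w)) ∇f_i(w
- α ∇f_i(w))`. Between `w` and any `u` this changes at rate at most `49/36 L + 7/6 ρα ‖∇f_i(w)‖`, a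
constant that involves only the base point `w`. Averaging over tasks gives the local Lipschitz
constant `lipBound` of `∇F` and a quadratic bound for `F` around `w` (`abs_F_sub_sub_inner_le`). It
is at most `7/12` of the quantity `smoothness` that `Ltilde` estimates.

For a fixed `w`, two facts about the random step are needed. The direction has second moment
controlled by `directionBound`, and its mean misses `∇F(w)` only because the inner gradient is
sampled; this bias is of order `σt/√Din` and is not reduced by `B`. The stepsize satisfies `E β ≥
1/(15 l)` and `E β² ≤ (25/1152)/l²` with `l = smoothness`, thanks to the requirements on `B'` and
`Dβ`. Direction and stepsize are independent, so the quadratic bound factors, and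
`integral_F_step_le` gives an expected decrease of `(‖∇F(w)‖²/60 - 0.11 s)/l`, where `s =
noiseLevel`.

As `l ≤ 4 (L + ρα(σ + ‖∇F(w)‖))`, the decrease is at least a multiple of `φ(‖∇F(w)‖)`, with `φ(x) =
x²/(L + ρα(σ + x))`, minus a noise term of order `s/L`. The function `φ` is convex and increasing,
so Jensen's inequality turns `E‖∇F(w_k)‖ ≥ m` into `E φ(‖∇F(w_k)‖) ≥ φ(m)`
(`sq_div_le_integral_progress`). If `φ(m)` dominates `s/L`, then as long as `E‖∇F(w_k)‖ > m` the
expected gap drops by at least `φ(m)/480` per iteration, so an index with value at most `m` occurs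
after at most `480 Δ/φ(m)` iterations (`exists_iterate_le`). The theorem takes `m` to be the maximum
in the statement: `φ(m) ≥ φ(ε)` yields the first bound on `k`, and `φ(m) ≥ (61/2) s/L ≥ σ²/(B L)`
yields the second. -/

set_option linter.unusedSectionVars false

/-! ### Deterministic bounds for a single task. -/

noncomputable section
namespace MAML
namespace Model

variable {d : ℕ} {ι : Type u} {Θ : Type v} [MeasurableSpace ι] [MeasurableSpace Θ]

/-- The gradient of the task objective `w ↦ f_i(w - α ∇f_i(w))`. -/
def taskGrad (M : Model d ι Θ) (α : ℝ) (i : ι) (w : Vec d) : Vec d :=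
  (ContinuousLinearMap.id ℝ (Vec d) - α • M.hess i w)
    (gradient (M.f i) (w - α • gradient (M.f i) w))

/-- The mean norm of the task gradients. -/
def meanNorm (M : Model d ι Θ) (w : Vec d) : ℝ := ∫ i, ‖gradient (M.f i) w‖ ∂M.p

/-- The local Lipschitz constant of the gradient of the MAML objective. -/
def lipBound (M : Model d ι Θ) (c : Constants) (w : Vec d) : ℝ :=
  49 / 36 * c.L + 7 / 6 * (c.ρ * c.α) * M.meanNorm w

variable {M : Model d ι Θ} {c : Constants}

namespace Assumptions

theorem hasGradientAt (h : M.Assumptions c) (i : ι) (w : Vec d) :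
    HasGradientAt (M.f i) (gradient (M.f i) w) w :=
  (((h.contDiff i).differentiable (by norm_num)) w).hasGradientAt

theorem differentiable_gradient (h : M.Assumptions c) (i : ι) :
    Differentiable ℝ (gradient (M.f i)) := by
  have h1 : Differentiable ℝ (fderiv ℝ (M.f i)) :=
    ((h.contDiff i).fderiv_right (m := 1) (by norm_num)).differentiable (by norm_num)
  exact fun w => ((InnerProductSpace.toDual ℝ (Vec d)).symm.differentiable _).comp w (h1 w)

theorem hasFDerivAt_gradient (h : M.Assumptions c) (i : ι) (w : Vec d) :
    HasFDerivAt (gradient (M.f i)) (M.hess i w) w :=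
  (h.differentiable_gradient i w).hasFDerivAt

theorem continuous_gradient (h : M.Assumptions c) (i : ι) : Continuous (gradient (M.f i)) :=
  (h.differentiable_gradient i).continuous

theorem norm_hess_le (h : M.Assumptions c) (i : ι) (w : Vec d) : ‖M.hess i w‖ ≤ c.L :=
  norm_fderiv_le_of_lip' ℝ h.L_pos.le (Filter.Eventually.of_forall fun x => h.smooth i x w)

/-- Symmetry of the second derivative of a `C²` function, carried through the Riesz isometry that
defines the gradient. -/
theorem inner_hess_comm (h : M.Assumptions c) (i : ι) (w x y : Vec d) :
    inner ℝ (M.hess i w x) y = inner ℝ x (M.hess i w y) := by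
  have h1 : Differentiable ℝ (fderiv ℝ (M.f i)) :=
    ((h.contDiff i).fderiv_right (m := 1) (by norm_num)).differentiable (by norm_num)
  have key : ∀ a b, inner ℝ (M.hess i w a) b = fderiv ℝ (fderiv ℝ (M.f i)) w a b := by
    intro a b
    have e1 := (h.hasFDerivAt_gradient i w).inner ℝ (hasFDerivAt_const b w)
    have e2 := (h1 w).hasFDerivAt.clm_apply (hasFDerivAt_const b w)
    have e3 : (fun x => inner ℝ (gradient (M.f i) x) b) = fun x => fderiv ℝ (M.f i) x b :=
      funext fun x => inner_gradient_left
    rw [e3] at e1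
    simpa using congrArg (fun T => T a) (e1.unique e2)
  have sym : IsSymmSndFDerivAt ℝ (M.f i) w :=
    (h.contDiff i).contDiffAt.isSymmSndFDerivAt (by simp)
  rw [key, real_inner_comm, key]
  exact sym x y

theorem norm_id_sub_hess_apply_le (h : M.Assumptions c) (hα : 0 < c.α) (hαL : c.α * c.L ≤ 1 / 6)
    (i : ι) (w x : Vec d) :
    ‖(ContinuousLinearMap.id ℝ (Vec d) - c.α • M.hess i w) x‖ ≤ 7 / 6 * ‖x‖ := by
  have h1 : ‖M.hess i w x‖ ≤ c.L * ‖x‖ :=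
    (M.hess i w).le_of_opNorm_le (h.norm_hess_le i w) x
  calc ‖(ContinuousLinearMap.id ℝ (Vec d) - c.α • M.hess i w) x‖
      = ‖x - c.α • M.hess i w x‖ := by simp
    _ ≤ ‖x‖ + ‖c.α • M.hess i w x‖ := norm_sub_le _ _
    _ = ‖x‖ + c.α * ‖M.hess i w x‖ := by rw [norm_smul, Real.norm_of_nonneg hα.le]
    _ ≤ ‖x‖ + c.α * (c.L * ‖x‖) := by gcongr
    _ = (1 + c.α * c.L) * ‖x‖ := by ring
    _ ≤ _ := by gcongr; linarith

/-- The gradient after a perturbed inner step. -/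
theorem norm_gradient_sub_smul_le (h : M.Assumptions c) (hα : 0 < c.α)
    (hαL : c.α * c.L ≤ 1 / 6) (i : ι) (w x : Vec d) :
    ‖gradient (M.f i) (w - c.α • x)‖ ≤ ‖gradient (M.f i) w‖ + 1 / 6 * ‖x‖ := by
  have h1 := h.smooth i (w - c.α • x) w
  have h2 : ‖w - c.α • x - w‖ = c.α * ‖x‖ := by
    rw [sub_sub_cancel_left, norm_neg, norm_smul, Real.norm_of_nonneg hα.le]
  rw [h2] at h1
  have h3 : ‖gradient (M.f i) (w - c.α • x)‖ ≤ ‖gradient (M.f i) w‖ +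
      ‖gradient (M.f i) (w - c.α • x) - gradient (M.f i) w‖ := norm_le_insert' _ _
  nlinarith [norm_nonneg x]

theorem norm_gradient_inner_le (h : M.Assumptions c) (hα : 0 < c.α)
    (hαL : c.α * c.L ≤ 1 / 6) (i : ι) (w : Vec d) :
    ‖gradient (M.f i) (w - c.α • gradient (M.f i) w)‖ ≤ 7 / 6 * ‖gradient (M.f i) w‖ := by
  have := h.norm_gradient_sub_smul_le hα hαL i w (gradient (M.f i) w)
  linarith

theorem norm_taskGrad_le (h : M.Assumptions c) (hα : 0 < c.α)
    (hαL : c.α * c.L ≤ 1 / 6) (i : ι) (w : Vec d) :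
    ‖M.taskGrad c.α i w‖ ≤ 49 / 36 * ‖gradient (M.f i) w‖ := by
  have h1 := h.norm_id_sub_hess_apply_le hα hαL i w
    (gradient (M.f i) (w - c.α • gradient (M.f i) w))
  have h2 := h.norm_gradient_inner_le hα hαL i w
  unfold taskGrad
  linarith

/-- Both modifications are small: the inner step moves the gradient by at most `1/6` of its norm,
and the Hessian factor removes at most `1/6 · 7/6` more; `1/6 + 7/36 = 13/36`. That this is below
`1` later allows `∇f` to be controlled by `∇F`. -/
theorem norm_taskGrad_sub_gradient_le (h : M.Assumptions c) (hα : 0 < c.α)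
    (hαL : c.α * c.L ≤ 1 / 6) (i : ι) (w : Vec d) :
    ‖M.taskGrad c.α i w - gradient (M.f i) w‖ ≤ 13 / 36 * ‖gradient (M.f i) w‖ := by
  set g := gradient (M.f i) w
  set g' := gradient (M.f i) (w - c.α • g)
  have h1 : ‖g' - g‖ ≤ 1 / 6 * ‖g‖ := by
    have h1 := h.smooth i (w - c.α • g) w
    have h2 : ‖w - c.α • g - w‖ = c.α * ‖g‖ := by
      rw [sub_sub_cancel_left, norm_neg, norm_smul, Real.norm_of_nonneg hα.le]
    rw [h2] at h1
    refine h1.trans ?_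
    nlinarith [norm_nonneg g]
  have h2 : ‖M.hess i w g'‖ ≤ c.L * ‖g'‖ := (M.hess i w).le_of_opNorm_le (h.norm_hess_le i w) _
  have h3 : ‖g'‖ ≤ 7 / 6 * ‖g‖ := h.norm_gradient_inner_le hα hαL i w
  have h4 : M.taskGrad c.α i w - g = (g' - g) - c.α • M.hess i w g' := by
    simp only [taskGrad, sub_apply, smul_apply,
      ContinuousLinearMap.id_apply, g', g]
    abel
  have h5 : ‖c.α • M.hess i w g'‖ ≤ 1 / 6 * ‖g'‖ := by
    rw [norm_smul, Real.norm_of_nonneg hα.le]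
    calc c.α * ‖M.hess i w g'‖ ≤ c.α * (c.L * ‖g'‖) := by gcongr
      _ = c.α * c.L * ‖g'‖ := by ring
      _ ≤ _ := by gcongr
  rw [h4]
  have := norm_sub_le (g' - g) (c.α • M.hess i w g')
  linarith

/-- Product rule for differences: varying the inner gradient costs `7/6 · L · 7/6`, varying the
Hessian costs `αρ` times the inner gradient. Placing the latter at `w` rather than at `u` makes the
constant depend on the base point alone. -/
theorem norm_taskGrad_sub_le (h : M.Assumptions c) (hα : 0 < c.α)
    (hαL : c.α * c.L ≤ 1 / 6) (i : ι) (w u : Vec d) :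
    ‖M.taskGrad c.α i u - M.taskGrad c.α i w‖ ≤
      (49 / 36 * c.L + 7 / 6 * (c.ρ * c.α) * ‖gradient (M.f i) w‖) * ‖u - w‖ := by
  set u' := u - c.α • gradient (M.f i) u
  set w' := w - c.α • gradient (M.f i) w
  have e : M.taskGrad c.α i u - M.taskGrad c.α i w =
      (ContinuousLinearMap.id ℝ (Vec d) - c.α • M.hess i u)
        (gradient (M.f i) u' - gradient (M.f i) w') -
      c.α • (M.hess i u - M.hess i w) (gradient (M.f i) w') := by
    simp only [taskGrad, sub_apply, smul_apply,
      ContinuousLinearMap.id_apply, u', w', map_sub, smul_sub]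
    abel
  have h1 : ‖u' - w'‖ ≤ 7 / 6 * ‖u - w‖ := by
    have e' : u' - w' = (u - w) - c.α • (gradient (M.f i) u - gradient (M.f i) w) := by
      simp only [u', w', smul_sub]; abel
    have h2 : ‖c.α • (gradient (M.f i) u - gradient (M.f i) w)‖ ≤ 1 / 6 * ‖u - w‖ := by
      rw [norm_smul, Real.norm_of_nonneg hα.le]
      calc _ ≤ c.α * (c.L * ‖u - w‖) := by gcongr; exact h.smooth i u w
        _ = c.α * c.L * ‖u - w‖ := by ring
        _ ≤ _ := by gcongr
    rw [e']
    linarith [norm_sub_le (u - w) (c.α • (gradient (M.f i) u - gradient (M.f i) w))]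
  have h2 := h.norm_id_sub_hess_apply_le hα hαL i u (gradient (M.f i) u' - gradient (M.f i) w')
  have h3 : ‖gradient (M.f i) u' - gradient (M.f i) w'‖ ≤ c.L * (7 / 6 * ‖u - w‖) :=
    (h.smooth i u' w').trans (by have := h.L_pos; gcongr)
  have h4 : ‖(M.hess i u - M.hess i w) (gradient (M.f i) w')‖ ≤
      c.ρ * ‖u - w‖ * (7 / 6 * ‖gradient (M.f i) w‖) := by
    refine (ContinuousLinearMap.le_opNorm _ _).trans ?_
    have := h.ρ_nonneg
    gcongr
    · exact h.hess_lipschitz i u w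
    · exact h.norm_gradient_inner_le hα hαL i w
  rw [e]
  refine (norm_sub_le _ _).trans ?_
  rw [norm_smul, Real.norm_of_nonneg hα.le]
  have h5 := mul_le_mul_of_nonneg_left h4 hα.le
  nlinarith

/-- The chain rule produces the adjoint of `I - α ∇²f_i(w)`; symmetry of the Hessian identifies it
with the operator in `taskGrad`. -/
theorem hasGradientAt_inner (h : M.Assumptions c) (i : ι) (w : Vec d) :
    HasGradientAt (fun w => M.f i (w - c.α • gradient (M.f i) w)) (M.taskGrad c.α i w) w := by
  rw [hasGradientAt_iff_hasFDerivAt]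
  have h1 : HasFDerivAt (fun w => w - c.α • gradient (M.f i) w)
      (ContinuousLinearMap.id ℝ (Vec d) - c.α • M.hess i w) w :=
    (hasFDerivAt_id w).sub ((h.hasFDerivAt_gradient i w).const_smul c.α)
  have h2 := (h.hasGradientAt i (w - c.α • gradient (M.f i) w)).hasFDerivAt.comp w h1
  refine h2.congr_fderiv ?_
  ext x
  simp [taskGrad, h.inner_hess_comm]

end Assumptions
end Model
end MAML
end

/-! ### Second moments and differentiation under the integral sign. -/

noncomputable section
namespace MAML

section SecondMoment

variable {Ω E : Type*} [MeasurableSpace Ω] [NormedAddCommGroup E] {μ : Measure Ω} {X : Ω → E}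

theorem enorm_sq_eq_ofReal (x : E) : ‖x‖ₑ ^ 2 = ENNReal.ofReal (‖x‖ ^ 2) := by
  rw [ENNReal.ofReal_pow (norm_nonneg x), ofReal_norm]

theorem memLp_two_of_lintegral_le (hX : AEStronglyMeasurable X μ) {C : ℝ}
    (h : ∫⁻ ω, ‖X ω‖ₑ ^ 2 ∂μ ≤ ENNReal.ofReal C) : MemLp X 2 μ := by
  rw [memLp_two_iff_integrable_sq_norm hX]
  refine ⟨(hX.norm.pow 2), ?_⟩
  refine lt_of_le_of_lt ?_ (lt_of_le_of_lt h ENNReal.ofReal_lt_top)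
  refine lintegral_mono fun ω => ?_
  simp [enorm_pow]

theorem memLp_two_of_lintegral_sub_le [IsFiniteMeasure μ] (hX : AEStronglyMeasurable X μ) (a : E)
    {C : ℝ} (h : ∫⁻ ω, ‖X ω - a‖ₑ ^ 2 ∂μ ≤ ENNReal.ofReal C) : MemLp X 2 μ := by
  have h1 : MemLp (fun ω => X ω - a) 2 μ :=
    memLp_two_of_lintegral_le (hX.sub aestronglyMeasurable_const) h
  refine (h1.add (memLp_const a)).congr_norm hX (Filter.Eventually.of_forall fun ω => ?_)
  simp

theorem integral_norm_sq_le_of_lintegral_le (hX : AEStronglyMeasurable X μ) {C : ℝ} (hC : 0 ≤ C)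
    (h : ∫⁻ ω, ‖X ω‖ₑ ^ 2 ∂μ ≤ ENNReal.ofReal C) : ∫ ω, ‖X ω‖ ^ 2 ∂μ ≤ C := by
  rw [integral_eq_lintegral_of_nonneg_ae (Filter.Eventually.of_forall fun ω => by positivity)
    (continuous_pow 2 |>.comp_aestronglyMeasurable hX.norm)]
  refine ENNReal.toReal_le_of_le_ofReal hC ?_
  simpa only [← enorm_sq_eq_ofReal] using h

theorem lintegral_enorm_sq_eq (hX : MemLp X 2 μ) :
    ∫⁻ ω, ‖X ω‖ₑ ^ 2 ∂μ = ENNReal.ofReal (∫ ω, ‖X ω‖ ^ 2 ∂μ) := by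
  rw [ofReal_integral_eq_lintegral_ofReal ((memLp_two_iff_integrable_sq_norm hX.1).1 hX)
    (Filter.Eventually.of_forall fun ω => by positivity)]
  simp only [enorm_sq_eq_ofReal]

theorem integral_sq_le_integral_sq [IsProbabilityMeasure μ] {Y : Ω → ℝ} (hY : MemLp Y 2 μ) :
    (∫ ω, Y ω ∂μ) ^ 2 ≤ ∫ ω, Y ω ^ 2 ∂μ := by
  have h1 := variance_nonneg Y μ
  rw [variance_eq_sub hY] at h1
  simp only [Pi.pow_apply] at h1
  linarith

theorem norm_integral_sq_le [NormedSpace ℝ E] [IsProbabilityMeasure μ] (hX : MemLp X 2 μ) :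
    ‖∫ ω, X ω ∂μ‖ ^ 2 ≤ ∫ ω, ‖X ω‖ ^ 2 ∂μ :=
  (pow_le_pow_left₀ (norm_nonneg _) (norm_integral_le_integral_norm X) 2).trans
    (integral_sq_le_integral_sq hX.norm)

/-- Bias-variance decomposition: the cross term is linear in `Y - E Y` and integrates to zero. -/
theorem integral_norm_sub_integral_sq {F : Type*} [NormedAddCommGroup F] [InnerProductSpace ℝ F]
    [CompleteSpace F] [IsProbabilityMeasure μ] {Y : Ω → F} (hY : MemLp Y 2 μ) (a : F) :
    ∫ ω, ‖Y ω - a‖ ^ 2 ∂μ =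
      ∫ ω, ‖Y ω - ∫ η, Y η ∂μ‖ ^ 2 ∂μ + ‖(∫ η, Y η ∂μ) - a‖ ^ 2 := by
  set m := ∫ η, Y η ∂μ
  have hi : Integrable Y μ := hY.integrable (by norm_num)
  have hm : MemLp (fun ω => Y ω - m) 2 μ := hY.sub (memLp_const m)
  have hint : Integrable (fun ω => ‖Y ω - m‖ ^ 2) μ := (memLp_two_iff_integrable_sq_norm hm.1).1 hm
  have hin : Integrable (fun ω => inner ℝ (Y ω - m) (m - a)) μ :=
    (hi.sub (integrable_const m)).inner_const (m - a)
  have e : ∀ ω, ‖Y ω - a‖ ^ 2 =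
      ‖Y ω - m‖ ^ 2 + 2 * inner ℝ (Y ω - m) (m - a) + ‖m - a‖ ^ 2 := by
    intro ω
    rw [← norm_add_sq_real]
    congr 2
    abel
  have e0 : ∫ ω, inner ℝ (Y ω - m) (m - a) ∂μ = 0 := by
    have : ∫ ω, inner ℝ (m - a) (Y ω - m) ∂μ = inner ℝ (m - a) (∫ ω, (Y ω - m) ∂μ) :=
      integral_inner (hi.sub (integrable_const m)) (m - a)
    simp_rw [real_inner_comm] at this ⊢
    rw [this, integral_sub hi (integrable_const m)]
    simp [m]
  simp_rw [e]
  have hsum : Integrable (fun ω => ‖Y ω - m‖ ^ 2 + 2 * inner ℝ (Y ω - m) (m - a)) μ :=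
    hint.add (hin.const_mul 2)
  rw [integral_add hsum (integrable_const _), integral_add hint (hin.const_mul 2), integral_const_mul, e0]
  simp

end SecondMoment

theorem hasGradientAt_integral {E : Type*} [NormedAddCommGroup E] [InnerProductSpace ℝ E]
    [CompleteSpace E] [SecondCountableTopology E] {ι : Type*} [MeasurableSpace ι] {p : Measure ι}
    {φ : ι → E → ℝ} {G : ι → E → E} {b : ι → ℝ} {w : E}
    (hφ : ∀ u, Integrable (fun i => φ i u) p)
    (hG : AEStronglyMeasurable (fun i => G i w) p)
    (hφG : ∀ i u, HasGradientAt (φ i) (G i u) u) (hb : Integrable b p)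
    (hGb : ∀ i, ∀ u ∈ Metric.ball w 1, ‖G i u‖ ≤ b i) :
    HasGradientAt (fun u => ∫ i, φ i u ∂p) (∫ i, G i w ∂p) w := by
  have hint : Integrable (fun i => G i w) p :=
    hb.mono' hG (Filter.Eventually.of_forall fun i => hGb i w (Metric.mem_ball_self one_pos))
  have hmeas : AEStronglyMeasurable (fun i => InnerProductSpace.toDual ℝ E (G i w)) p :=
    (InnerProductSpace.toDual ℝ E).continuous.comp_aestronglyMeasurable hG
  have key := hasFDerivAt_integral_of_dominated_of_fderiv_le (𝕜 := ℝ) (μ := p)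
    (F := fun u i => φ i u) (F' := fun u i => InnerProductSpace.toDual ℝ E (G i u)) (x₀ := w)
    (bound := b) (Metric.ball_mem_nhds w one_pos)
    (Filter.Eventually.of_forall fun u => (hφ u).1) (hφ w) hmeas
    (Filter.Eventually.of_forall fun i u hu => by simpa using hGb i u hu) hb
    (Filter.Eventually.of_forall fun i u _ => (hφG i u).hasFDerivAt)
  rw [hasGradientAt_iff_hasFDerivAt]
  refine key.congr_fderiv ?_
  have hd : Integrable (fun i => InnerProductSpace.toDual ℝ E (G i w)) p :=
    hb.mono' hmeas (Filter.Eventually.of_forall fun i => by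
      simpa using hGb i w (Metric.mem_ball_self one_pos))
  ext x
  rw [ContinuousLinearMap.integral_apply hd]
  simp only [InnerProductSpace.toDual_apply_apply]
  have := integral_inner hint x (𝕜 := ℝ)
  simpa only [real_inner_comm x] using this

/-! ### The MAML objective: gradient, local smoothness, comparison with the expected loss. -/

namespace Model

variable {d : ℕ} {ι : Type u} {Θ : Type v} [MeasurableSpace ι] [MeasurableSpace Θ]
  [Countable ι] [DiscreteMeasurableSpace ι] {M : Model d ι Θ} {c : Constants}

namespace Assumptions

/-- Here `gradient M.meanLoss w` serves only as some fixed vector. The integrability obtained in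
this way is what justifies differentiating `meanLoss` under the integral, so that
`gradient_meanLoss` can identify this vector with the mean. -/
theorem memLp_gradient (h : M.Assumptions c) (w : Vec d) :
    MemLp (fun i => gradient (M.f i) w) 2 M.p := by
  have := h.prob_task
  have h1 : MemLp (fun i => gradient M.meanLoss w - gradient (M.f i) w) 2 M.p :=
    memLp_two_of_lintegral_le Measurable.of_discrete.aestronglyMeasurable (h.task_variance w)
  refine ((memLp_const (gradient M.meanLoss w)).sub h1).congr_norm
    Measurable.of_discrete.aestronglyMeasurable (Filter.Eventually.of_forall fun i => ?_)
  simp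

theorem integrable_norm_gradient (h : M.Assumptions c) (w : Vec d) :
    Integrable (fun i => ‖gradient (M.f i) w‖) M.p := by
  have := h.prob_task
  exact ((h.memLp_gradient w).integrable (by norm_num)).norm

theorem integrable_norm_gradient_sq (h : M.Assumptions c) (w : Vec d) :
    Integrable (fun i => ‖gradient (M.f i) w‖ ^ 2) M.p :=
  (memLp_two_iff_integrable_sq_norm (h.memLp_gradient w).1).1 (h.memLp_gradient w)

theorem norm_gradient_le_of_mem_ball (h : M.Assumptions c) (i : ι) (w u : Vec d)
    (hu : u ∈ Metric.ball w 1) : ‖gradient (M.f i) u‖ ≤ ‖gradient (M.f i) w‖ + c.L := by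
  have h1 := h.smooth i u w
  rw [mem_ball_iff_norm] at hu
  have h3 : ‖gradient (M.f i) u‖ ≤ ‖gradient (M.f i) w‖ +
      ‖gradient (M.f i) u - gradient (M.f i) w‖ := norm_le_insert' _ _
  nlinarith [h.L_pos]

theorem gradient_meanLoss (h : M.Assumptions c) (w : Vec d) :
    gradient M.meanLoss w = ∫ i, gradient (M.f i) w ∂M.p := by
  have := h.prob_task
  exact (hasGradientAt_integral (G := fun i => gradient (M.f i)) h.integrable_loss
    Measurable.of_discrete.aestronglyMeasurable h.hasGradientAt
    ((h.integrable_norm_gradient w).add (integrable_const c.L))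
    fun i u hu => h.norm_gradient_le_of_mem_ball i w u hu).gradient

/-- Integrability is assumed only for `f_i(w)`. The inner step changes this value by at most a
multiple of `‖∇f_i(w)‖²`, by the mean value inequality on the segment, and the gradients are square
integrable over tasks. -/
theorem integrable_inner_loss (h : M.Assumptions c) (hα : 0 < c.α) (hαL : c.α * c.L ≤ 1 / 6)
    (w : Vec d) : Integrable (fun i => M.f i (w - c.α • gradient (M.f i) w)) M.p := by
  have hb : ∀ i, ‖M.f i (w - c.α • gradient (M.f i) w) - M.f i w‖ ≤
      7 / 6 * c.α * ‖gradient (M.f i) w‖ ^ 2 := by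
    intro i
    set g := gradient (M.f i) w
    have hs : ∀ x ∈ segment ℝ w (w - c.α • g), ‖fderiv ℝ (M.f i) x‖ ≤ 7 / 6 * ‖g‖ := by
      intro x hx
      have e : ‖fderiv ℝ (M.f i) x‖ = ‖gradient (M.f i) x‖ := by
        rw [← toDual_gradient, LinearIsometryEquiv.norm_map]
      have h1 := h.smooth i x w
      have h2 : ‖x - w‖ ≤ c.α * ‖g‖ := by
        have := norm_sub_le_of_mem_segment hx
        rwa [sub_sub_cancel_left, norm_neg, norm_smul, Real.norm_of_nonneg hα.le] at this
      have h3 : ‖gradient (M.f i) x‖ ≤ ‖g‖ + ‖gradient (M.f i) x - g‖ := norm_le_insert' _ _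
      have h4 : c.L * ‖x - w‖ ≤ c.L * (c.α * ‖g‖) := mul_le_mul_of_nonneg_left h2 h.L_pos.le
      rw [e]
      nlinarith [norm_nonneg g]
    have := (convex_segment w (w - c.α • g)).norm_image_sub_le_of_norm_fderiv_le
      (f := M.f i) (𝕜 := ℝ) (fun x _ => (h.hasGradientAt i x).differentiableAt) hs
      (left_mem_segment ℝ _ _) (right_mem_segment ℝ _ _)
    rw [sub_sub_cancel_left, norm_neg, norm_smul, Real.norm_of_nonneg hα.le] at this
    calc _ ≤ _ := this
      _ = _ := by ring
  have h1 : Integrable (fun i => M.f i (w - c.α • gradient (M.f i) w) - M.f i w) M.p :=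
    ((h.integrable_norm_gradient_sq w).const_mul _).mono'
      Measurable.of_discrete.aestronglyMeasurable (Filter.Eventually.of_forall hb)
  exact (h1.add (h.integrable_loss w)).congr (Filter.Eventually.of_forall fun i => by simp)

theorem hasGradientAt_F (h : M.Assumptions c) (hα : 0 < c.α) (hαL : c.α * c.L ≤ 1 / 6)
    (w : Vec d) : HasGradientAt (M.F c.α) (∫ i, M.taskGrad c.α i w ∂M.p) w := by
  have := h.prob_task
  refine hasGradientAt_integral (G := fun i => M.taskGrad c.α i)
    (b := fun i => 49 / 36 * (‖gradient (M.f i) w‖ + c.L)) (h.integrable_inner_loss hα hαL)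
    Measurable.of_discrete.aestronglyMeasurable h.hasGradientAt_inner
    (((h.integrable_norm_gradient w).add (integrable_const c.L)).const_mul _) fun i u hu => ?_
  exact (h.norm_taskGrad_le hα hαL i u).trans
    (mul_le_mul_of_nonneg_left (h.norm_gradient_le_of_mem_ball i w u hu) (by norm_num))

theorem gradient_F (h : M.Assumptions c) (hα : 0 < c.α) (hαL : c.α * c.L ≤ 1 / 6) (w : Vec d) :
    gradient (M.F c.α) w = ∫ i, M.taskGrad c.α i w ∂M.p :=
  (h.hasGradientAt_F hα hαL w).gradient

theorem differentiable_F (h : M.Assumptions c) (hα : 0 < c.α) (hαL : c.α * c.L ≤ 1 / 6) :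
    Differentiable ℝ (M.F c.α) :=
  fun w => (h.hasGradientAt_F hα hαL w).differentiableAt

theorem integrable_taskGrad (h : M.Assumptions c) (hα : 0 < c.α) (hαL : c.α * c.L ≤ 1 / 6)
    (w : Vec d) : Integrable (fun i => M.taskGrad c.α i w) M.p :=
  ((h.integrable_norm_gradient w).const_mul (49 / 36)).mono'
    Measurable.of_discrete.aestronglyMeasurable
    (Filter.Eventually.of_forall fun i => h.norm_taskGrad_le hα hαL i w)

theorem meanNorm_nonneg (w : Vec d) : 0 ≤ M.meanNorm w :=
  integral_nonneg fun _ => norm_nonneg _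

theorem lipBound_nonneg (h : M.Assumptions c) (hα : 0 < c.α) (w : Vec d) :
    0 ≤ M.lipBound c w := by
  have := h.L_pos
  have := h.ρ_nonneg
  have := meanNorm_nonneg (M := M) w
  unfold lipBound
  positivity

theorem norm_gradient_F_sub_le (h : M.Assumptions c) (hα : 0 < c.α) (hαL : c.α * c.L ≤ 1 / 6)
    (w u : Vec d) :
    ‖gradient (M.F c.α) u - gradient (M.F c.α) w‖ ≤ M.lipBound c w * ‖u - w‖ := by
  have := h.prob_task
  rw [h.gradient_F hα hαL, h.gradient_F hα hαL,
    ← integral_sub (h.integrable_taskGrad hα hαL u) (h.integrable_taskGrad hα hαL w)]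
  have hi : Integrable (fun i => (49 / 36 * c.L + 7 / 6 * (c.ρ * c.α) * ‖gradient (M.f i) w‖)) M.p :=
    (integrable_const _).add ((h.integrable_norm_gradient w).const_mul _)
  refine (norm_integral_le_of_norm_le (hi.mul_const ‖u - w‖) (Filter.Eventually.of_forall fun i =>
    h.norm_taskGrad_sub_le hα hαL i w u)).trans_eq ?_
  rw [integral_mul_const, integral_add (integrable_const _)
    ((h.integrable_norm_gradient w).const_mul _)]
  simp [lipBound, meanNorm, integral_const_mul]

theorem continuous_gradient_F (h : M.Assumptions c) (hα : 0 < c.α) (hαL : c.α * c.L ≤ 1 / 6) :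
    Continuous (gradient (M.F c.α)) := by
  rw [continuous_iff_continuousAt]
  intro w
  rw [ContinuousAt, tendsto_iff_norm_sub_tendsto_zero]
  refine squeeze_zero (fun _ => norm_nonneg _) (h.norm_gradient_F_sub_le hα hαL w) ?_
  have : Continuous fun u : Vec d => M.lipBound c w * ‖u - w‖ := by fun_prop
  simpa using this.tendsto w

/-- The mean value inequality on the ball of radius `‖u - w‖` around `w`; it gives up the factor
`1/2` of the integrated version, which the later constants can afford. The two-sided form also
supplies the integrability of `F` after a random step. -/
theorem abs_F_sub_sub_inner_le (h : M.Assumptions c) (hα : 0 < c.α) (hαL : c.α * c.L ≤ 1 / 6) (w u : Vec d) :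
    |M.F c.α u - M.F c.α w - inner ℝ (gradient (M.F c.α) w) (u - w)| ≤
      M.lipBound c w * ‖u - w‖ ^ 2 := by
  have h0 := h.lipBound_nonneg hα w
  have := (convex_closedBall w ‖u - w‖).norm_image_sub_le_of_norm_hasFDerivWithin_le'
    (f := M.F c.α) (φ := fderiv ℝ (M.F c.α) w) (C := M.lipBound c w * ‖u - w‖)
    (fun x _ => (h.differentiable_F hα hαL x).hasFDerivAt.hasFDerivWithinAt)
    (fun x hx => by
      rw [← toDual_gradient, ← toDual_gradient, ← map_sub, LinearIsometryEquiv.norm_map]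
      refine (h.norm_gradient_F_sub_le hα hαL w x).trans ?_
      rw [mem_closedBall_iff_norm] at hx
      gcongr) (Metric.mem_closedBall_self (norm_nonneg _)) (y := u) (by simp [dist_eq_norm])
  rw [← inner_gradient_left, Real.norm_eq_abs] at this
  calc _ ≤ _ := this
    _ = _ := by ring

theorem integral_norm_gradient_sub_sq_le (h : M.Assumptions c) (w : Vec d) :
    ∫ i, ‖gradient (M.f i) w - gradient M.meanLoss w‖ ^ 2 ∂M.p ≤ c.σ ^ 2 := by
  simp_rw [norm_sub_rev _ (gradient M.meanLoss w)]
  exact integral_norm_sq_le_of_lintegral_le Measurable.of_discrete.aestronglyMeasurable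
    (sq_nonneg _) (h.task_variance w)

theorem integral_norm_gradient_sq_le (h : M.Assumptions c) (w : Vec d) :
    ∫ i, ‖gradient (M.f i) w‖ ^ 2 ∂M.p ≤ ‖gradient M.meanLoss w‖ ^ 2 + c.σ ^ 2 := by
  have := h.prob_task
  have h1 := integral_norm_sub_integral_sq (h.memLp_gradient w) 0
  have h2 := h.integral_norm_gradient_sub_sq_le w
  rw [h.gradient_meanLoss] at h2 ⊢
  simp only [sub_zero] at h1
  linarith

theorem meanNorm_le (h : M.Assumptions c) (w : Vec d) :
    M.meanNorm w ≤ ‖gradient M.meanLoss w‖ + c.σ := by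
  have := h.prob_task
  have h1 := (integral_sq_le_integral_sq (h.memLp_gradient w).norm).trans
    (h.integral_norm_gradient_sq_le w)
  have := h.σ_pos
  refine abs_le_of_sq_le_sq' ?_ (by positivity) |>.2
  change (∫ i, ‖gradient (M.f i) w‖ ∂M.p) ^ 2 ≤ _
  nlinarith [norm_nonneg (gradient M.meanLoss w)]

/-- From `‖∇F - ∇f‖ ≤ 13/36 (‖∇f‖ + σ)`, solving for `‖∇f‖` leaves the factor `1 - 13/36 = 23/36` on
the left. -/
theorem norm_gradient_meanLoss_le (h : M.Assumptions c) (hα : 0 < c.α)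
    (hαL : c.α * c.L ≤ 1 / 6) (w : Vec d) :
    ‖gradient M.meanLoss w‖ ≤ 36 / 23 * ‖gradient (M.F c.α) w‖ + 13 / 23 * c.σ := by
  have := h.prob_task
  have h1 : ‖gradient (M.F c.α) w - gradient M.meanLoss w‖ ≤ 13 / 36 * M.meanNorm w := by
    rw [h.gradient_F hα hαL, h.gradient_meanLoss, ← integral_sub (h.integrable_taskGrad hα hαL w)
      ((h.memLp_gradient w).integrable (by norm_num)), meanNorm, ← integral_const_mul]
    exact norm_integral_le_of_norm_le ((h.integrable_norm_gradient w).const_mul _)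
      (Filter.Eventually.of_forall fun i => h.norm_taskGrad_sub_gradient_le hα hαL i w)
  have h2 := h.meanNorm_le w
  have h3 : ‖gradient M.meanLoss w‖ ≤ ‖gradient (M.F c.α) w‖ +
    ‖gradient (M.F c.α) w - gradient M.meanLoss w‖ := norm_le_insert _ _
  linarith

theorem meanNorm_le_gradient_F (h : M.Assumptions c) (hα : 0 < c.α)
    (hαL : c.α * c.L ≤ 1 / 6) (w : Vec d) :
    M.meanNorm w ≤ 36 / 23 * (‖gradient (M.F c.α) w‖ + c.σ) := by
  have h1 := h.meanNorm_le w
  have h2 := h.norm_gradient_meanLoss_le hα hαL w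
  linarith

end Assumptions
end Model
end MAML
end

/-! ### Averages of i.i.d. samples, minibatch gradients and Hessians. -/

noncomputable section
namespace MAML

section Average

variable {S : Type*} [MeasurableSpace S] {ν : Measure S} [IsProbabilityMeasure ν] {m : ℕ}

theorem memLp_average {E : Type*} [NormedAddCommGroup E] [NormedSpace ℝ E] {Y : S → E}
    (hY : MemLp Y 2 ν) :
    MemLp (fun x : Fin m → S => (m : ℝ)⁻¹ • ∑ j, Y (x j)) 2 (Measure.pi fun _ : Fin m => ν) :=
  (memLp_finsetSum _ fun j _ =>
    hY.comp_measurePreserving (measurePreserving_eval (fun _ : Fin m => ν) j)).const_smul _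

theorem integral_average {E : Type*} [NormedAddCommGroup E] [NormedSpace ℝ E] {Y : S → E}
    (hY : Integrable Y ν) (hm : 0 < m) :
    ∫ x : Fin m → S, (m : ℝ)⁻¹ • ∑ j, Y (x j) ∂(Measure.pi fun _ : Fin m => ν) = ∫ s, Y s ∂ν := by
  have hm' : (m : ℝ) ≠ 0 := by positivity
  rw [integral_smul, integral_finsetSum _ fun j _ =>
    integrable_comp_eval (μ := fun _ : Fin m => ν) (i := j) hY]
  simp_rw [integral_comp_eval (μ := fun _ : Fin m => ν) hY.1]
  rw [Finset.sum_const, Finset.card_univ, Fintype.card_fin, ← Nat.cast_smul_eq_nsmul ℝ, smul_smul,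
    inv_mul_cancel₀ hm', one_smul]

theorem integral_average_sub_sq {y : S → ℝ} (hy : MemLp y 2 ν) (hm : 0 < m) :
    ∫ x : Fin m → S, ((m : ℝ)⁻¹ * ∑ j, y (x j) - ∫ s, y s ∂ν) ^ 2
      ∂(Measure.pi fun _ : Fin m => ν) = (∫ s, (y s - ∫ t, y t ∂ν) ^ 2 ∂ν) / m := by
  have hm' : (m : ℝ) ≠ 0 := by positivity
  have hi : Integrable y ν := hy.integrable (by norm_num)
  have h1 := integral_average (m := m) hi hm
  have h2 := memLp_average (m := m) hy
  simp only [smul_eq_mul] at h1 h2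
  have h3 := variance_sum_pi (μ := fun _ : Fin m => ν) (X := fun _ => y) fun _ => hy
  have h4 := variance_eq_integral h2.aemeasurable
  rw [h1] at h4
  rw [← h4, variance_const_mul, ← variance_eq_integral hy.aemeasurable]
  have e : (∑ i : Fin m, fun ω : Fin m → S => y (ω i)) = fun ω => ∑ i, y (ω i) := by
    ext ω; simp
  rw [e] at h3
  rw [h3]
  simp
  field_simp

/-- The squared Euclidean norm splits into coordinates, each of which is a scalar variance of an
average. -/
theorem integral_norm_average_sub_sq {d : ℕ} {Y : S → Vec d} (hY : MemLp Y 2 ν) (hm : 0 < m) :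
    ∫ x : Fin m → S, ‖(m : ℝ)⁻¹ • ∑ j, Y (x j) - ∫ s, Y s ∂ν‖ ^ 2
      ∂(Measure.pi fun _ : Fin m => ν) = (∫ s, ‖Y s - ∫ t, Y t ∂ν‖ ^ 2 ∂ν) / m := by
  have hi : Integrable Y ν := hY.integrable (by norm_num)
  have hc : ∀ k, MemLp (fun s => Y s k) 2 ν := fun k =>
    (EuclideanSpace.proj k : Vec d →L[ℝ] ℝ).comp_memLp' hY
  have hint : ∀ k, (∫ s, Y s ∂ν) k = ∫ s, Y s k ∂ν := fun k =>
    ((EuclideanSpace.proj k : Vec d →L[ℝ] ℝ).integral_comp_comm hi).symm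
  have h1 : ∀ k, Integrable (fun s => (Y s k - ∫ t, Y t k ∂ν) ^ 2) ν := fun k =>
    ((hc k).sub (memLp_const _)).integrable_sq
  have h2 : ∀ k, Integrable (fun x : Fin m → S =>
      ((m : ℝ)⁻¹ * ∑ j, Y (x j) k - ∫ s, Y s k ∂ν) ^ 2) (Measure.pi fun _ : Fin m => ν) := fun k =>
    ((memLp_average (m := m) (hc k)).sub (memLp_const _)).integrable_sq
  simp only [EuclideanSpace.real_norm_sq_eq, PiLp.sub_apply, PiLp.smul_apply, smul_eq_mul,
    WithLp.ofLp_sum, Finset.sum_apply, hint]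
  rw [integral_finsetSum _ fun k _ => h1 k, integral_finsetSum _ fun k _ => h2 k, Finset.sum_div]
  exact Finset.sum_congr rfl fun k _ => integral_average_sub_sq (hc k) hm

end Average

namespace Model

variable {d : ℕ} {ι : Type u} {Θ : Type v} [MeasurableSpace ι] [MeasurableSpace Θ]
  {M : Model d ι Θ} {c : Constants}

namespace Assumptions

theorem measurable_g_right (h : M.Assumptions c) (i : ι) (w : Vec d) : Measurable (M.g i w) :=
  (h.measurable_g i).comp measurable_prodMk_left

theorem measurable_H_right (h : M.Assumptions c) (i : ι) (w : Vec d) : Measurable (M.H i w) :=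
  (h.measurable_H i).comp measurable_prodMk_left

theorem memLp_g (h : M.Assumptions c) (i : ι) (w : Vec d) : MemLp (M.g i w) 2 (M.ν i) := by
  have := h.prob_data i
  exact memLp_two_of_lintegral_sub_le (h.measurable_g_right i w).aestronglyMeasurable _
    (h.variance_g i w)

theorem memLp_H (h : M.Assumptions c) (i : ι) (w : Vec d) : MemLp (M.H i w) 2 (M.ν i) := by
  have := h.prob_data i
  exact memLp_two_of_lintegral_sub_le (h.measurable_H_right i w).aestronglyMeasurable _
    (h.variance_H i w)

theorem integral_norm_g_sub_sq_le (h : M.Assumptions c) (i : ι) (w : Vec d) :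
    ∫ θ, ‖M.g i w θ - gradient (M.f i) w‖ ^ 2 ∂M.ν i ≤ c.σt ^ 2 :=
  integral_norm_sq_le_of_lintegral_le
    ((h.measurable_g_right i w).sub_const _).aestronglyMeasurable (sq_nonneg _) (h.variance_g i w)

theorem integral_norm_H_sub_sq_le (h : M.Assumptions c) (i : ι) (w : Vec d) :
    ∫ θ, ‖M.H i w θ - M.hess i w‖ ^ 2 ∂M.ν i ≤ c.σH ^ 2 :=
  integral_norm_sq_le_of_lintegral_le
    ((h.measurable_H_right i w).aestronglyMeasurable.sub aestronglyMeasurable_const)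
    (sq_nonneg _) (h.variance_H i w)

variable {m : ℕ}

theorem measurable_batchGrad (h : M.Assumptions c) (i : ι) {X : Type*} [MeasurableSpace X]
    {f : X → Vec d} {D : X → Fin m → Θ} (hf : Measurable f) (hD : Measurable D) :
    Measurable fun x => M.batchGrad i (f x) (D x) := by
  have h1 : Measurable fun x => ∑ j, M.g i (f x) (D x j) := by
    refine Finset.measurable_fun_sum _ fun j _ => ?_
    have h2 : Measurable fun x => (f x, D x j) := hf.prodMk ((measurable_pi_apply j).comp hD)
    exact (h.measurable_g i).comp h2
  exact h1.const_smul (m : ℝ)⁻¹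

theorem measurable_batchHess_apply (h : M.Assumptions c) (i : ι) {X : Type*} [MeasurableSpace X]
    {f v : X → Vec d} {D : X → Fin m → Θ} (hf : Measurable f) (hD : Measurable D)
    (hv : Measurable v) : Measurable fun x => M.batchHess i (f x) (D x) (v x) := by
  have h1 : Measurable fun x => ∑ j, M.H i (f x) (D x j) := by
    refine Finset.measurable_fun_sum _ fun j _ => ?_
    have h2 : Measurable fun x => (f x, D x j) := hf.prodMk ((measurable_pi_apply j).comp hD)
    exact (h.measurable_H i).comp h2
  have h2 : Measurable fun x => ((M.batchHess i (f x) (D x), v x) : (Vec d →L[ℝ] Vec d) × Vec d) :=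
    (h1.const_smul (m : ℝ)⁻¹).prodMk hv
  have h3 : Measurable fun y : (Vec d →L[ℝ] Vec d) × Vec d => y.1 y.2 :=
    isBoundedBilinearMap_apply.continuous.measurable
  exact h3.comp h2

theorem memLp_batchGrad (h : M.Assumptions c) (i : ι) (w : Vec d) :
    MemLp (fun D : Fin m → Θ => M.batchGrad i w D) 2 (Measure.pi fun _ => M.ν i) := by
  have := h.prob_data i
  exact memLp_average (h.memLp_g i w)

theorem integral_batchGrad (h : M.Assumptions c) (hm : 0 < m) (i : ι) (w : Vec d) :
    ∫ D : Fin m → Θ, M.batchGrad i w D ∂(Measure.pi fun _ => M.ν i) = gradient (M.f i) w := by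
  have := h.prob_data i
  rw [← h.unbiased_g]
  exact integral_average ((h.memLp_g i w).integrable (by norm_num)) hm

theorem integral_norm_batchGrad_sub_sq_le (h : M.Assumptions c) (hm : 0 < m) (i : ι) (w : Vec d) :
    ∫ D : Fin m → Θ, ‖M.batchGrad i w D - gradient (M.f i) w‖ ^ 2 ∂(Measure.pi fun _ => M.ν i) ≤
      c.σt ^ 2 / m := by
  have := h.prob_data i
  have h1 := integral_norm_average_sub_sq (h.memLp_g i w) hm
  rw [h.unbiased_g] at h1
  exact h1.trans_le (div_le_div_of_nonneg_right (h.integral_norm_g_sub_sq_le i w) (by positivity))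

theorem integral_norm_batchGrad_sq_le (h : M.Assumptions c) (hm : 0 < m) (i : ι) (w : Vec d) :
    ∫ D : Fin m → Θ, ‖M.batchGrad i w D‖ ^ 2 ∂(Measure.pi fun _ => M.ν i) ≤
      ‖gradient (M.f i) w‖ ^ 2 + c.σt ^ 2 / m := by
  have := h.prob_data i
  have h1 := integral_norm_sub_integral_sq (h.memLp_batchGrad (m := m) i w) 0
  rw [h.integral_batchGrad hm] at h1
  have h2 := h.integral_norm_batchGrad_sub_sq_le hm i w
  simp only [sub_zero] at h1
  linarith

theorem memLp_H_apply (h : M.Assumptions c) (i : ι) (w x : Vec d) :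
    MemLp (fun θ => M.H i w θ x) 2 (M.ν i) :=
  (ContinuousLinearMap.apply ℝ (Vec d) x).comp_memLp' (h.memLp_H i w)

theorem batchHess_apply (i : ι) (w x : Vec d) (D : Fin m → Θ) :
    M.batchHess i w D x = (m : ℝ)⁻¹ • ∑ j, M.H i w (D j) x := by
  simp [batchHess]

theorem integral_H_apply (h : M.Assumptions c) (i : ι) (w x : Vec d) :
    ∫ θ, M.H i w θ x ∂M.ν i = M.hess i w x := by
  have := h.prob_data i
  rw [← ContinuousLinearMap.integral_apply ((h.memLp_H i w).integrable (by norm_num)),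
    h.unbiased_H]

theorem memLp_batchHess_apply (h : M.Assumptions c) (i : ι) (w x : Vec d) :
    MemLp (fun D : Fin m → Θ => M.batchHess i w D x) 2 (Measure.pi fun _ => M.ν i) := by
  have := h.prob_data i
  simp only [batchHess_apply]
  exact memLp_average (Y := fun θ => M.H i w θ x) (h.memLp_H_apply i w x)

theorem integral_batchHess_apply (h : M.Assumptions c) (hm : 0 < m) (i : ι) (w x : Vec d) :
    ∫ D : Fin m → Θ, M.batchHess i w D x ∂(Measure.pi fun _ => M.ν i) = M.hess i w x := by
  have := h.prob_data i
  simp only [batchHess_apply]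
  rw [integral_average (Y := fun θ => M.H i w θ x) ((h.memLp_H_apply i w x).integrable (by norm_num)) hm, h.integral_H_apply]

/-- The operator norm does not come from an inner product, so the gain `1/m` is not available for it
directly. Applied to a fixed `x`, the stochastic Hessians become Euclidean vectors, for which
variances add. -/
theorem integral_norm_batchHess_apply_sub_sq_le (h : M.Assumptions c) (hm : 0 < m) (i : ι)
    (w x : Vec d) :
    ∫ D : Fin m → Θ, ‖M.batchHess i w D x - M.hess i w x‖ ^ 2 ∂(Measure.pi fun _ => M.ν i) ≤
      c.σH ^ 2 / m * ‖x‖ ^ 2 := by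
  have := h.prob_data i
  have h1 := integral_norm_average_sub_sq (h.memLp_H_apply i w x) hm
  rw [h.integral_H_apply] at h1
  simp only [batchHess_apply]
  rw [h1, div_mul_eq_mul_div]
  gcongr
  have h2 : Integrable (fun θ => ‖M.H i w θ - M.hess i w‖ ^ 2) (M.ν i) := by
    have h3 : MemLp (fun θ => M.H i w θ - M.hess i w) 2 (M.ν i) :=
      (h.memLp_H i w).sub (memLp_const _)
    exact (memLp_two_iff_integrable_sq_norm h3.1).1 h3
  calc ∫ θ, ‖M.H i w θ x - M.hess i w x‖ ^ 2 ∂M.ν i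
      ≤ ∫ θ, ‖M.H i w θ - M.hess i w‖ ^ 2 * ‖x‖ ^ 2 ∂M.ν i := by
        refine integral_mono_of_nonneg (Filter.Eventually.of_forall fun θ => by positivity)
          (h2.mul_const _) (Filter.Eventually.of_forall fun θ => ?_)
        dsimp only
        rw [← mul_pow]
        gcongr
        exact (M.H i w θ - M.hess i w).le_opNorm x
    _ ≤ _ := by
        rw [integral_mul_const]
        gcongr
        exact h.integral_norm_H_sub_sq_le i w

theorem memLp_id_sub_batchHess_apply (h : M.Assumptions c) (i : ι) (w x : Vec d) :
    MemLp (fun D : Fin m → Θ => (ContinuousLinearMap.id ℝ (Vec d) - c.α • M.batchHess i w D) x) 2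
      (Measure.pi fun _ => M.ν i) := by
  have := h.prob_data i
  exact (memLp_const x).sub ((h.memLp_batchHess_apply (m := m) i w x).const_smul c.α)

theorem integral_id_sub_batchHess_apply (h : M.Assumptions c) (hm : 0 < m) (i : ι) (w x : Vec d) :
    ∫ D : Fin m → Θ, (ContinuousLinearMap.id ℝ (Vec d) - c.α • M.batchHess i w D) x
      ∂(Measure.pi fun _ => M.ν i) =
    (ContinuousLinearMap.id ℝ (Vec d) - c.α • M.hess i w) x := by
  have := h.prob_data i
  simp only [sub_apply, smul_apply, ContinuousLinearMap.id_apply]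
  have h1 : Integrable (fun D : Fin m → Θ => c.α • M.batchHess i w D x)
      (Measure.pi fun _ => M.ν i) :=
    ((h.memLp_batchHess_apply (m := m) i w x).integrable (by norm_num)).smul c.α
  rw [integral_sub (integrable_const _) h1, integral_smul,
    h.integral_batchHess_apply hm]
  simp

/-- The mean operator contributes `(7/6)² = 49/36` and the variance at most `α² σH² / m ≤ 1/2`; the
sum is `67/36`. -/
theorem integral_norm_id_sub_batchHess_apply_sq_le (h : M.Assumptions c) (hα : 0 < c.α)
    (hαL : c.α * c.L ≤ 1 / 6) (hm : 0 < m) (hmH : 2 * c.α ^ 2 * c.σH ^ 2 ≤ m) (i : ι)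
    (w x : Vec d) :
    ∫ D : Fin m → Θ, ‖(ContinuousLinearMap.id ℝ (Vec d) - c.α • M.batchHess i w D) x‖ ^ 2
      ∂(Measure.pi fun _ => M.ν i) ≤ 67 / 36 * ‖x‖ ^ 2 := by
  have := h.prob_data i
  have h1 := integral_norm_sub_integral_sq (h.memLp_id_sub_batchHess_apply (m := m) i w x) 0
  rw [h.integral_id_sub_batchHess_apply hm] at h1
  simp only [sub_zero] at h1
  rw [h1]
  have h2 := h.norm_id_sub_hess_apply_le hα hαL i w x
  have h3 : ∀ D : Fin m → Θ, ‖(ContinuousLinearMap.id ℝ (Vec d) - c.α • M.batchHess i w D) x -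
      (ContinuousLinearMap.id ℝ (Vec d) - c.α • M.hess i w) x‖ ^ 2 =
      c.α ^ 2 * ‖M.batchHess i w D x - M.hess i w x‖ ^ 2 := by
    intro D
    have : (ContinuousLinearMap.id ℝ (Vec d) - c.α • M.batchHess i w D) x -
      (ContinuousLinearMap.id ℝ (Vec d) - c.α • M.hess i w) x =
      -(c.α • (M.batchHess i w D x - M.hess i w x)) := by
      simp only [sub_apply, smul_apply, smul_sub]; abel
    rw [this, norm_neg, norm_smul, Real.norm_of_nonneg hα.le, mul_pow]
  simp only [h3]
  rw [integral_const_mul]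
  have h4 := mul_le_mul_of_nonneg_left (h.integral_norm_batchHess_apply_sub_sq_le hm i w x)
    (sq_nonneg c.α)
  have h5 : c.α ^ 2 * (c.σH ^ 2 / m) ≤ 1 / 2 := by
    have : (0 : ℝ) < m := by positivity
    rw [← mul_div_assoc, div_le_iff₀ this]
    linarith
  have h6 := mul_le_mul_of_nonneg_right h5 (sq_nonneg ‖x‖)
  have h7 := pow_le_pow_left₀ (norm_nonneg _) h2 2
  nlinarith

end Assumptions
end Model
end MAML
end

/-! ### The update direction: second moment and bias. -/

noncomputable section
namespace MAML
namespace Model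

variable {d : ℕ} {ι : Type u} {Θ : Type v} [MeasurableSpace ι] [MeasurableSpace Θ]
  {M : Model d ι Θ} {c : Constants} {n : BatchSizes}

/-- The law of the three datasets of task `i`. -/
def dataLaw (M : Model d ι Θ) (n : BatchSizes) (i : ι) :
    Measure ((Fin n.Din → Θ) × (Fin n.Do → Θ) × (Fin n.Dh → Θ)) :=
  (Measure.pi fun _ : Fin n.Din => M.ν i).prod
    ((Measure.pi fun _ : Fin n.Do => M.ν i).prod (Measure.pi fun _ : Fin n.Dh => M.ν i))

/-- The bound on the second moment of the contribution of one task. -/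
def directionBound (M : Model d ι Θ) (c : Constants) (n : BatchSizes) (w : Vec d) : ℝ :=
  67 / 36 * (49 / 18 * (‖gradient M.meanLoss w‖ ^ 2 + c.σ ^ 2) + 1 / 18 * (c.σt ^ 2 / n.Din)
    + c.σt ^ 2 / n.Do)

namespace Assumptions

theorem isProbabilityMeasure_dataLaw (h : M.Assumptions c) (i : ι) :
    IsProbabilityMeasure (M.dataLaw n i) := by
  have := h.prob_data i
  unfold dataLaw
  infer_instance

theorem measurable_direction_data (h : M.Assumptions c) (α : ℝ) (i : ι) {X : Type*}
    [MeasurableSpace X] {f : X → Vec d}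
    {D : X → (Fin n.Din → Θ) × (Fin n.Do → Θ) × (Fin n.Dh → Θ)}
    (hf : Measurable f) (hD : Measurable D) :
    Measurable fun x => M.direction α n (f x) (i, D x) := by
  have h1 : Measurable fun x => M.batchGrad i (f x) (D x).1 := h.measurable_batchGrad i hf hD.fst
  have h2 : Measurable fun x => f x - α • M.batchGrad i (f x) (D x).1 := hf.sub (h1.const_smul α)
  have h3 : Measurable fun x =>
      M.batchGrad i (f x - α • M.batchGrad i (f x) (D x).1) (D x).2.1 :=
    h.measurable_batchGrad i h2 hD.snd.fst
  have h4 : Measurable fun x => M.batchHess i (f x) (D x).2.2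
      (M.batchGrad i (f x - α • M.batchGrad i (f x) (D x).1) (D x).2.1) :=
    h.measurable_batchHess_apply i hf hD.snd.snd h3
  exact h3.sub (h4.const_smul α)

/-- Measurability is assumed task by task only; countability of the discrete task space makes this
joint measurability. -/
theorem measurable_direction [Countable ι] [DiscreteMeasurableSpace ι] (h : M.Assumptions c)
    (α : ℝ) {X : Type*} [MeasurableSpace X] {f : X → Vec d} {t : X → TaskSample ι Θ n}
    (hf : Measurable f) (ht : Measurable t) : Measurable fun x => M.direction α n (f x) (t x) := by
  let Data := (Fin n.Din → Θ) × (Fin n.Do → Θ) × (Fin n.Dh → Θ)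
  let Φ : ι × (Vec d × Data) → Vec d := fun y => M.direction α n y.2.1 (y.1, y.2.2)
  have h1 : Measurable Φ := measurable_from_prod_countable_right fun i =>
    h.measurable_direction_data α i measurable_fst measurable_snd
  let Ψ : X → ι × (Vec d × Data) := fun x => ((t x).1, (f x, (t x).2))
  have h2 : Measurable Ψ := ht.fst.prodMk (hf.prodMk ht.snd)
  have e : (fun x => M.direction α n (f x) (t x)) = fun x => Φ (Ψ x) := by
    funext x
    simp only [Φ, Ψ, Prod.mk.eta]
  rw [e]
  exact h1.comp h2

theorem memLp_gradient_inner (h : M.Assumptions c) (hα : 0 < c.α) (hαL : c.α * c.L ≤ 1 / 6)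
    {m : ℕ} (i : ι) (w : Vec d) :
    MemLp (fun D : Fin m → Θ => gradient (M.f i) (w - c.α • M.batchGrad i w D)) 2
      (Measure.pi fun _ => M.ν i) := by
  have := h.prob_data i
  have h1 : Measurable fun D : Fin m → Θ => M.batchGrad i w D :=
    h.measurable_batchGrad i measurable_const measurable_id
  have h2 : Measurable fun D : Fin m → Θ => w - c.α • M.batchGrad i w D := by fun_prop
  have h3 : Measurable fun D : Fin m → Θ => gradient (M.f i) (w - c.α • M.batchGrad i w D) :=
    (h.continuous_gradient i).measurable.comp h2
  have h4 : MemLp (fun _ : Fin m → Θ => ‖gradient (M.f i) w‖) 2 (Measure.pi fun _ => M.ν i) :=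
    memLp_const _
  have h5 : MemLp (fun D : Fin m → Θ => 1 / 6 * ‖M.batchGrad i w D‖) 2
      (Measure.pi fun _ => M.ν i) := (h.memLp_batchGrad (m := m) i w).norm.const_mul (1 / 6)
  exact (h4.add h5).mono' h3.aestronglyMeasurable
    (Filter.Eventually.of_forall fun D => h.norm_gradient_sub_smul_le hα hαL i w _)

theorem norm_gradient_inner_sub_le (h : M.Assumptions c) (hα : 0 < c.α)
    (hαL : c.α * c.L ≤ 1 / 6) (i : ι) (w x : Vec d) :
    ‖gradient (M.f i) (w - c.α • x) - gradient (M.f i) (w - c.α • gradient (M.f i) w)‖ ≤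
      1 / 6 * ‖x - gradient (M.f i) w‖ := by
  refine (h.smooth i _ _).trans ?_
  rw [sub_sub_sub_cancel_left, ← smul_sub, norm_smul, Real.norm_of_nonneg hα.le,
    norm_sub_rev (gradient (M.f i) w)]
  nlinarith [norm_nonneg (x - gradient (M.f i) w)]

theorem integral_norm_gradient_inner_sq_le (h : M.Assumptions c) (hα : 0 < c.α)
    (hαL : c.α * c.L ≤ 1 / 6) {m : ℕ} (hm : 0 < m) (i : ι) (w : Vec d) :
    ∫ D : Fin m → Θ, ‖gradient (M.f i) (w - c.α • M.batchGrad i w D)‖ ^ 2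
      ∂(Measure.pi fun _ => M.ν i) ≤
    49 / 18 * ‖gradient (M.f i) w‖ ^ 2 + 1 / 18 * (c.σt ^ 2 / m) := by
  have := h.prob_data i
  have hY : MemLp (fun D : Fin m → Θ => M.batchGrad i w D - gradient (M.f i) w) 2
      (Measure.pi fun _ => M.ν i) := (h.memLp_batchGrad i w).sub (memLp_const _)
  have hi := (memLp_two_iff_integrable_sq_norm hY.1).1 hY
  calc _ ≤ ∫ D : Fin m → Θ, (49 / 18 * ‖gradient (M.f i) w‖ ^ 2 +
        1 / 18 * ‖M.batchGrad i w D - gradient (M.f i) w‖ ^ 2) ∂(Measure.pi fun _ => M.ν i) := by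
        refine integral_mono_of_nonneg (Filter.Eventually.of_forall fun D => by positivity)
          ((integrable_const _).add (hi.const_mul _)) (Filter.Eventually.of_forall fun D => ?_)
        have h1 := h.norm_gradient_inner_sub_le hα hαL i w (M.batchGrad i w D)
        have h2 := h.norm_gradient_inner_le hα hαL i w
        have h3 := norm_le_insert' (gradient (M.f i) (w - c.α • M.batchGrad i w D))
          (gradient (M.f i) (w - c.α • gradient (M.f i) w))
        dsimp only
        set x := ‖gradient (M.f i) w‖
        set y := ‖M.batchGrad i w D - gradient (M.f i) w‖
        have h4 : ‖gradient (M.f i) (w - c.α • M.batchGrad i w D)‖ ≤ 7 / 6 * x + 1 / 6 * y := by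
          linarith
        have h5 := pow_le_pow_left₀ (norm_nonneg _) h4 2
        -- `(7/6 x + 1/6 y)² ≤ 2 (7/6)² x² + 2 (1/6)² y²`.
        nlinarith [sq_nonneg (7 * x - y)]
    _ = 49 / 18 * ‖gradient (M.f i) w‖ ^ 2 + 1 / 18 *
        ∫ D : Fin m → Θ, ‖M.batchGrad i w D - gradient (M.f i) w‖ ^ 2
          ∂(Measure.pi fun _ => M.ν i) := by
        rw [integral_add (integrable_const _) (hi.const_mul _)]
        simp [integral_const_mul]
    _ ≤ _ := by
        gcongr
        exact h.integral_norm_batchGrad_sub_sq_le hm i w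

/-- The three datasets are independent, so they are integrated out one at a time from the outermost
operation inwards: the Hessian sample acts on a frozen vector, the outer gradient is sampled at a
frozen point, and the inner sample comes last. -/
theorem lintegral_direction_data_le (h : M.Assumptions c) (hα : 0 < c.α)
    (hαL : c.α * c.L ≤ 1 / 6) (hn : n.Admissible c) (i : ι) (w : Vec d) :
    ∫⁻ y, ‖M.direction c.α n w (i, y)‖ₑ ^ 2 ∂(M.dataLaw n i) ≤
      ENNReal.ofReal (67 / 36 * (49 / 18 * ‖gradient (M.f i) w‖ ^ 2 + 1 / 18 * (c.σt ^ 2 / n.Din)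
        + c.σt ^ 2 / n.Do)) := by
  have := h.prob_data i
  have hmeas : Measurable fun y => ‖M.direction c.α n w (i, y)‖ₑ ^ 2 :=
    (h.measurable_direction_data c.α i measurable_const measurable_id).enorm.pow_const 2
  have hDh : 2 * c.α ^ 2 * c.σH ^ 2 ≤ n.Dh := Nat.ceil_le.1 hn.Dh_ge
  have h1 : ∀ x : Vec d, ∫⁻ e : Fin n.Dh → Θ,
      ‖(ContinuousLinearMap.id ℝ (Vec d) - c.α • M.batchHess i w e) x‖ₑ ^ 2
        ∂(Measure.pi fun _ => M.ν i) ≤ ENNReal.ofReal (67 / 36 * ‖x‖ ^ 2) := by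
    intro x
    rw [lintegral_enorm_sq_eq (h.memLp_id_sub_batchHess_apply i w x)]
    exact ENNReal.ofReal_le_ofReal
      (h.integral_norm_id_sub_batchHess_apply_sq_le hα hαL hn.Dh_pos hDh i w x)
  have h2 : ∀ u : Vec d, ∫⁻ b : Fin n.Do → Θ, ENNReal.ofReal (67 / 36 * ‖M.batchGrad i u b‖ ^ 2)
        ∂(Measure.pi fun _ => M.ν i) ≤
      ENNReal.ofReal (67 / 36 * (‖gradient (M.f i) u‖ ^ 2 + c.σt ^ 2 / n.Do)) := by
    intro u
    have hY := h.memLp_batchGrad (m := n.Do) i u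
    rw [← ofReal_integral_eq_lintegral_ofReal
      (((memLp_two_iff_integrable_sq_norm hY.1).1 hY).const_mul _)
      (Filter.Eventually.of_forall fun b => by positivity), integral_const_mul]
    gcongr
    exact h.integral_norm_batchGrad_sq_le hn.Do_pos i u
  have hY := h.memLp_gradient_inner hα hαL (m := n.Din) i w
  have hYi := (memLp_two_iff_integrable_sq_norm hY.1).1 hY
  rw [dataLaw, lintegral_prod _ hmeas.aemeasurable]
  calc _ ≤ ∫⁻ a : Fin n.Din → Θ, ENNReal.ofReal
        (67 / 36 * (‖gradient (M.f i) (w - c.α • M.batchGrad i w a)‖ ^ 2 + c.σt ^ 2 / n.Do))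
          ∂(Measure.pi fun _ => M.ν i) := by
        refine lintegral_mono fun a => ?_
        have ha : Measurable fun y => ‖M.direction c.α n w (i, (a, y))‖ₑ ^ 2 :=
          hmeas.comp measurable_prodMk_left
        rw [lintegral_prod _ ha.aemeasurable]
        exact (lintegral_mono fun b => h1 _).trans (h2 _)
    _ ≤ _ := by
        have hYa : Integrable (fun a : Fin n.Din → Θ => 67 / 36 *
            (‖gradient (M.f i) (w - c.α • M.batchGrad i w a)‖ ^ 2 + c.σt ^ 2 / n.Do))
            (Measure.pi fun _ => M.ν i) := (hYi.add (integrable_const _)).const_mul _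
        rw [← ofReal_integral_eq_lintegral_ofReal hYa
          (Filter.Eventually.of_forall fun b => by positivity), integral_const_mul,
          integral_add hYi (integrable_const _)]
        have := h.integral_norm_gradient_inner_sq_le hα hαL hn.Din_pos i w
        gcongr
        simp

theorem memLp_direction_data (h : M.Assumptions c) (hα : 0 < c.α)
    (hαL : c.α * c.L ≤ 1 / 6) (hn : n.Admissible c) (i : ι) (w : Vec d) :
    MemLp (fun y => M.direction c.α n w (i, y)) 2 (M.dataLaw n i) :=
  memLp_two_of_lintegral_le
    (h.measurable_direction_data c.α i measurable_const measurable_id).aestronglyMeasurable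
    (h.lintegral_direction_data_le hα hαL hn i w)

/-- The direction is linear in the Hessian sample and in the outer gradient sample, so both are
replaced by their means. The inner sample sits inside the nonlinear map `∇f_i` and remains; it is
the sole source of bias. -/
theorem integral_direction_data (h : M.Assumptions c) (hα : 0 < c.α)
    (hαL : c.α * c.L ≤ 1 / 6) (hn : n.Admissible c) (i : ι) (w : Vec d) :
    ∫ y, M.direction c.α n w (i, y) ∂(M.dataLaw n i) =
      ∫ a : Fin n.Din → Θ, (ContinuousLinearMap.id ℝ (Vec d) - c.α • M.hess i w)
        (gradient (M.f i) (w - c.α • M.batchGrad i w a)) ∂(Measure.pi fun _ => M.ν i) := by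
  have := h.prob_data i
  have := h.isProbabilityMeasure_dataLaw (n := n) i
  have hint : Integrable (fun y => M.direction c.α n w (i, y)) (M.dataLaw n i) :=
    (h.memLp_direction_data hα hαL hn i w).integrable (by norm_num)
  rw [dataLaw] at hint ⊢
  rw [integral_prod _ hint]
  refine integral_congr_ae ?_
  filter_upwards [hint.prod_right_ae] with a ha
  rw [integral_prod _ ha]
  simp only [direction]
  simp_rw [h.integral_id_sub_batchHess_apply hn.Dh_pos]
  rw [ContinuousLinearMap.integral_comp_comm _
    ((h.memLp_batchGrad (m := n.Do) i _).integrable (by norm_num)), h.integral_batchGrad hn.Do_pos]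

/-- The inner sampling error is contracted by `1/6` through `α∇f_i` and multiplied by at most `7/6`
by the Hessian factor; `49/1296 = (7/36)²`. -/
theorem norm_integral_direction_data_sub_sq_le (h : M.Assumptions c) (hα : 0 < c.α)
    (hαL : c.α * c.L ≤ 1 / 6) (hn : n.Admissible c) (i : ι) (w : Vec d) :
    ‖∫ y, M.direction c.α n w (i, y) ∂(M.dataLaw n i) - M.taskGrad c.α i w‖ ^ 2 ≤
      49 / 1296 * (c.σt ^ 2 / n.Din) := by
  have := h.prob_data i
  set T := ContinuousLinearMap.id ℝ (Vec d) - c.α • M.hess i w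
  have hG := h.memLp_gradient_inner hα hαL (m := n.Din) i w
  have hTG : MemLp (fun a : Fin n.Din → Θ => T (gradient (M.f i) (w - c.α • M.batchGrad i w a))) 2
      (Measure.pi fun _ => M.ν i) := T.comp_memLp' hG
  have hY : MemLp (fun D : Fin n.Din → Θ => M.batchGrad i w D - gradient (M.f i) w) 2
      (Measure.pi fun _ => M.ν i) := (h.memLp_batchGrad i w).sub (memLp_const _)
  have hi := (memLp_two_iff_integrable_sq_norm hY.1).1 hY
  have e : ∫ y, M.direction c.α n w (i, y) ∂(M.dataLaw n i) - M.taskGrad c.α i w =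
      ∫ a : Fin n.Din → Θ, (T (gradient (M.f i) (w - c.α • M.batchGrad i w a)) -
        M.taskGrad c.α i w) ∂(Measure.pi fun _ => M.ν i) := by
    rw [h.integral_direction_data hα hαL hn,
      integral_sub (hTG.integrable (by norm_num)) (integrable_const _), integral_const]
    simp only [probReal_univ, one_smul, T]
  rw [e]
  refine (norm_integral_sq_le (hTG.sub (memLp_const _))).trans ?_
  calc _ ≤ ∫ a : Fin n.Din → Θ, 49 / 1296 * ‖M.batchGrad i w a - gradient (M.f i) w‖ ^ 2
        ∂(Measure.pi fun _ => M.ν i) := by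
        refine integral_mono_of_nonneg (Filter.Eventually.of_forall fun D => by positivity)
          (hi.const_mul _) (Filter.Eventually.of_forall fun D => ?_)
        have h1 := h.norm_gradient_inner_sub_le hα hαL i w (M.batchGrad i w D)
        have h2 := h.norm_id_sub_hess_apply_le hα hαL i w
          (gradient (M.f i) (w - c.α • M.batchGrad i w D) -
            gradient (M.f i) (w - c.α • gradient (M.f i) w))
        rw [map_sub] at h2
        have h3 := h2.trans (mul_le_mul_of_nonneg_left h1 (by norm_num))
        have h4 := pow_le_pow_left₀ (norm_nonneg _) h3 2
        refine h4.trans_eq ?_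
        ring
    _ ≤ _ := by
        rw [integral_const_mul]
        gcongr
        exact h.integral_norm_batchGrad_sub_sq_le hn.Din_pos i w

section Law

variable [Countable ι] [DiscreteMeasurableSpace ι]

theorem isProbabilityMeasure_taskLaw (h : M.Assumptions c) :
    IsProbabilityMeasure (M.taskLaw n) := by
  have := h.prob_task
  have : IsMarkovKernel (Kernel.ofFunOfCountable fun i => M.dataLaw n i) :=
    ⟨fun i => h.isProbabilityMeasure_dataLaw i⟩
  change IsProbabilityMeasure (M.p ⊗ₘ (Kernel.ofFunOfCountable fun i => M.dataLaw n i))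
  infer_instance

theorem lintegral_taskLaw (h : M.Assumptions c) {φ : TaskSample ι Θ n → ENNReal}
    (hφ : Measurable φ) :
    ∫⁻ x, φ x ∂(M.taskLaw n) = ∫⁻ i, ∫⁻ y, φ (i, y) ∂(M.dataLaw n i) ∂M.p := by
  have := h.prob_task
  have : IsMarkovKernel (Kernel.ofFunOfCountable fun i => M.dataLaw n i) :=
    ⟨fun i => h.isProbabilityMeasure_dataLaw i⟩
  exact Measure.lintegral_compProd (κ := Kernel.ofFunOfCountable fun i => M.dataLaw n i) hφ

theorem integral_taskLaw (h : M.Assumptions c) {φ : TaskSample ι Θ n → Vec d}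
    (hφ : Integrable φ (M.taskLaw n)) :
    ∫ x, φ x ∂(M.taskLaw n) = ∫ i, ∫ y, φ (i, y) ∂(M.dataLaw n i) ∂M.p := by
  have := h.prob_task
  have : IsMarkovKernel (Kernel.ofFunOfCountable fun i => M.dataLaw n i) :=
    ⟨fun i => h.isProbabilityMeasure_dataLaw i⟩
  exact Measure.integral_compProd (κ := Kernel.ofFunOfCountable fun i => M.dataLaw n i) hφ

theorem lintegral_direction_le (h : M.Assumptions c) (hα : 0 < c.α)
    (hαL : c.α * c.L ≤ 1 / 6) (hn : n.Admissible c) (w : Vec d) :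
    ∫⁻ x, ‖M.direction c.α n w x‖ₑ ^ 2 ∂(M.taskLaw n) ≤
      ENNReal.ofReal (M.directionBound c n w) := by
  have := h.prob_task
  have hm : Measurable fun x : TaskSample ι Θ n => ‖M.direction c.α n w x‖ₑ ^ 2 :=
    (h.measurable_direction c.α measurable_const measurable_id).enorm.pow_const 2
  rw [h.lintegral_taskLaw hm]
  refine (lintegral_mono fun i => h.lintegral_direction_data_le hα hαL hn i w).trans ?_
  have hi := h.integrable_norm_gradient_sq w
  have hi2 : Integrable (fun i => 67 / 36 * (49 / 18 * ‖gradient (M.f i) w‖ ^ 2 +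
      1 / 18 * (c.σt ^ 2 / n.Din) + c.σt ^ 2 / n.Do)) M.p :=
    (((hi.const_mul _).add (integrable_const _)).add (integrable_const _)).const_mul _
  rw [← ofReal_integral_eq_lintegral_ofReal hi2 (Filter.Eventually.of_forall fun b => by positivity),
    integral_const_mul]
  unfold directionBound
  have h1 := h.integral_norm_gradient_sq_le w
  gcongr
  have hi' : Integrable (fun i => 49 / 18 * ‖gradient (M.f i) w‖ ^ 2 +
      1 / 18 * (c.σt ^ 2 / n.Din)) M.p := (hi.const_mul _).add (integrable_const _)
  rw [integral_add hi' (integrable_const _), integral_add (hi.const_mul _) (integrable_const _),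
    integral_const_mul]
  simp only [integral_const, probReal_univ, one_smul]
  gcongr

theorem memLp_direction (h : M.Assumptions c) (hα : 0 < c.α)
    (hαL : c.α * c.L ≤ 1 / 6) (hn : n.Admissible c) (w : Vec d) :
    MemLp (M.direction c.α n w) 2 (M.taskLaw n) :=
  memLp_two_of_lintegral_le
    (h.measurable_direction c.α measurable_const measurable_id).aestronglyMeasurable
    (h.lintegral_direction_le hα hαL hn w)

theorem directionBound_nonneg (w : Vec d) : 0 ≤ M.directionBound c n w := by
  unfold directionBound
  positivity

theorem integral_norm_direction_sq_le (h : M.Assumptions c) (hα : 0 < c.α)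
    (hαL : c.α * c.L ≤ 1 / 6) (hn : n.Admissible c) (w : Vec d) :
    ∫ x, ‖M.direction c.α n w x‖ ^ 2 ∂(M.taskLaw n) ≤ M.directionBound c n w :=
  integral_norm_sq_le_of_lintegral_le (h.memLp_direction hα hαL hn w).1
    (directionBound_nonneg w) (h.lintegral_direction_le hα hαL hn w)

theorem norm_integral_direction_sub_sq_le (h : M.Assumptions c) (hα : 0 < c.α)
    (hαL : c.α * c.L ≤ 1 / 6) (hn : n.Admissible c) (w : Vec d) :
    ‖∫ x, M.direction c.α n w x ∂(M.taskLaw n) - gradient (M.F c.α) w‖ ^ 2 ≤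
      49 / 1296 * (c.σt ^ 2 / n.Din) := by
  have := h.prob_task
  have := h.isProbabilityMeasure_taskLaw (n := n)
  have hb : ∀ i, ‖∫ y, M.direction c.α n w (i, y) ∂(M.dataLaw n i) - M.taskGrad c.α i w‖ ≤
      Real.sqrt (49 / 1296 * (c.σt ^ 2 / n.Din)) := fun i =>
    Real.le_sqrt_of_sq_le (h.norm_integral_direction_data_sub_sq_le hα hαL hn i w)
  have hd : Integrable (fun i => ∫ y, M.direction c.α n w (i, y) ∂(M.dataLaw n i) -
      M.taskGrad c.α i w) M.p :=
    (integrable_const _).mono' Measurable.of_discrete.aestronglyMeasurable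
      (Filter.Eventually.of_forall hb)
  have hT := h.integrable_taskGrad hα hαL w
  have e : ∫ x, M.direction c.α n w x ∂(M.taskLaw n) - gradient (M.F c.α) w =
      ∫ i, (∫ y, M.direction c.α n w (i, y) ∂(M.dataLaw n i) - M.taskGrad c.α i w) ∂M.p := by
    rw [h.integral_taskLaw ((h.memLp_direction hα hαL hn w).integrable (by norm_num)),
      h.gradient_F hα hαL, ← integral_sub _ hT]
    exact (hd.add hT).congr (Filter.Eventually.of_forall fun i => by simp)
  rw [e]
  have h1 := norm_integral_le_of_norm_le_const (μ := M.p) (Filter.Eventually.of_forall hb)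
  simp only [probReal_univ, mul_one] at h1
  exact (pow_le_pow_left₀ (norm_nonneg _) h1 2).trans_eq (Real.sq_sqrt (by positivity))

/-- The mean of a batch of update directions. -/
theorem integral_batch_direction (h : M.Assumptions c) (hα : 0 < c.α)
    (hαL : c.α * c.L ≤ 1 / 6) (hn : n.Admissible c) (w : Vec d) :
    ∫ x : Fin n.B → TaskSample ι Θ n, (n.B : ℝ)⁻¹ • ∑ b, M.direction c.α n w (x b)
      ∂(Measure.pi fun _ => M.taskLaw n) = ∫ x, M.direction c.α n w x ∂(M.taskLaw n) := by
  have := h.isProbabilityMeasure_taskLaw (n := n)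
  exact integral_average ((h.memLp_direction hα hαL hn w).integrable (by norm_num))
    (by have := hn.B_ge; omega)

theorem memLp_batch_direction (h : M.Assumptions c) (hα : 0 < c.α)
    (hαL : c.α * c.L ≤ 1 / 6) (hn : n.Admissible c) (w : Vec d) :
    MemLp (fun x : Fin n.B → TaskSample ι Θ n => (n.B : ℝ)⁻¹ • ∑ b, M.direction c.α n w (x b)) 2
      (Measure.pi fun _ => M.taskLaw n) := by
  have := h.isProbabilityMeasure_taskLaw (n := n)
  exact memLp_average (h.memLp_direction hα hαL hn w)

/-- Only the variance is divided by `B`; it is bounded by the second moment of one contribution. -/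
theorem integral_norm_batch_direction_sq_le (h : M.Assumptions c) (hα : 0 < c.α)
    (hαL : c.α * c.L ≤ 1 / 6) (hn : n.Admissible c) (w : Vec d) :
    ∫ x : Fin n.B → TaskSample ι Θ n, ‖(n.B : ℝ)⁻¹ • ∑ b, M.direction c.α n w (x b)‖ ^ 2
      ∂(Measure.pi fun _ => M.taskLaw n) ≤
    ‖∫ x, M.direction c.α n w x ∂(M.taskLaw n)‖ ^ 2 + M.directionBound c n w / n.B := by
  have := h.isProbabilityMeasure_taskLaw (n := n)
  have hB : 0 < n.B := by have := hn.B_ge; omega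
  have hG := h.memLp_direction hα hαL hn w
  have h1 := integral_norm_sub_integral_sq (h.memLp_batch_direction hα hαL hn w) 0
  have h2 := integral_norm_average_sub_sq hG hB
  have h3 := integral_norm_sub_integral_sq hG 0
  rw [h.integral_batch_direction hα hαL hn] at h1
  simp only [sub_zero] at h1 h3
  rw [h1, h2, add_comm]
  gcongr
  have := h.integral_norm_direction_sq_le hα hαL hn w
  nlinarith [sq_nonneg ‖∫ x, M.direction c.α n w x ∂(M.taskLaw n)‖]

end Law

end Assumptions
end Model
end MAML
end

/-! ### Moments of the random stepsize. -/

noncomputable section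
namespace MAML
namespace Model

variable {d : ℕ} {ι : Type u} {Θ : Type v} [MeasurableSpace ι] [MeasurableSpace Θ]
  {M : Model d ι Θ} {c : Constants} {n : BatchSizes}

/-- The smoothness parameter `4 L + 2 ρ α E‖∇f_i(w)‖` which `Ltilde` estimates. -/
def smoothness (M : Model d ι Θ) (c : Constants) (w : Vec d) : ℝ :=
  4 * c.L + 2 * c.ρ * c.α * M.meanNorm w

namespace Assumptions

theorem measurable_batchGrad_step [Countable ι] [DiscreteMeasurableSpace ι] (h : M.Assumptions c)
    {X : Type*} [MeasurableSpace X] {f : X → Vec d} {t : X → StepSample ι Θ n}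
    (hf : Measurable f) (ht : Measurable t) :
    Measurable fun x => M.batchGrad (t x).1 (f x) (t x).2 := by
  let Φ : ι × (Vec d × (Fin n.Dβ → Θ)) → Vec d := fun y => M.batchGrad y.1 y.2.1 y.2.2
  have h1 : Measurable Φ := measurable_from_prod_countable_right fun i =>
    h.measurable_batchGrad i measurable_fst measurable_snd
  have h2 : Measurable fun x => ((t x).1, (f x, (t x).2)) := ht.fst.prodMk (hf.prodMk ht.snd)
  exact h1.comp h2

section Law

variable [Countable ι] [DiscreteMeasurableSpace ι]

theorem isMarkovKernel_step (h : M.Assumptions c) :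
    IsMarkovKernel (Kernel.ofFunOfCountable fun i => Measure.pi fun _ : Fin n.Dβ => M.ν i) :=
  ⟨fun i => by have := h.prob_data i; change IsProbabilityMeasure (Measure.pi _); infer_instance⟩

theorem isProbabilityMeasure_stepLaw (h : M.Assumptions c) :
    IsProbabilityMeasure (M.stepLaw n) := by
  have := h.prob_task
  have := h.isMarkovKernel_step (n := n)
  unfold stepLaw
  infer_instance

theorem lintegral_batchGrad_step_sub_sq_le (h : M.Assumptions c) (hn : n.Admissible c)
    (w : Vec d) :
    ∫⁻ s, ‖M.batchGrad s.1 w s.2 - gradient M.meanLoss w‖ₑ ^ 2 ∂(M.stepLaw n) ≤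
      ENNReal.ofReal (c.σ ^ 2 + c.σt ^ 2 / n.Dβ) := by
  have := h.prob_task
  have := h.isMarkovKernel_step (n := n)
  have hm : Measurable fun s : StepSample ι Θ n =>
      ‖M.batchGrad s.1 w s.2 - gradient M.meanLoss w‖ₑ ^ 2 :=
    ((h.measurable_batchGrad_step measurable_const measurable_id).sub_const _).enorm.pow_const 2
  rw [stepLaw, Measure.lintegral_compProd hm]
  have hg : MemLp (fun i => gradient (M.f i) w - gradient M.meanLoss w) 2 M.p :=
    (h.memLp_gradient w).sub (memLp_const _)
  have hgi := (memLp_two_iff_integrable_sq_norm hg.1).1 hg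
  calc _ ≤ ∫⁻ i, ENNReal.ofReal (‖gradient (M.f i) w - gradient M.meanLoss w‖ ^ 2 +
        c.σt ^ 2 / n.Dβ) ∂M.p := by
        refine lintegral_mono fun i => ?_
        have := h.prob_data i
        have hb := h.memLp_batchGrad (m := n.Dβ) i w
        have hb' : MemLp (fun D : Fin n.Dβ → Θ => M.batchGrad i w D - gradient M.meanLoss w) 2
          (Measure.pi fun _ => M.ν i) := hb.sub (memLp_const _)
        have e := integral_norm_sub_integral_sq hb (gradient M.meanLoss w)
        rw [h.integral_batchGrad hn.Dβ_pos] at e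
        change ∫⁻ D : Fin n.Dβ → Θ, ‖M.batchGrad i w D - gradient M.meanLoss w‖ₑ ^ 2
          ∂(Measure.pi fun _ => M.ν i) ≤ _
        rw [lintegral_enorm_sq_eq hb', e]
        have := h.integral_norm_batchGrad_sub_sq_le hn.Dβ_pos i w
        exact ENNReal.ofReal_le_ofReal (by linarith)
    _ ≤ _ := by
        have hi : Integrable (fun i => ‖gradient (M.f i) w - gradient M.meanLoss w‖ ^ 2 +
          c.σt ^ 2 / n.Dβ) M.p := hgi.add (integrable_const _)
        rw [← ofReal_integral_eq_lintegral_ofReal hi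
          (Filter.Eventually.of_forall fun i => by positivity), integral_add hgi (integrable_const _)]
        have := h.integral_norm_gradient_sub_sq_le w
        refine ENNReal.ofReal_le_ofReal ?_
        simpa using this

theorem memLp_batchGrad_step (h : M.Assumptions c) (hn : n.Admissible c) (w : Vec d) :
    MemLp (fun s => M.batchGrad s.1 w s.2) 2 (M.stepLaw n) := by
  have := h.isProbabilityMeasure_stepLaw (n := n)
  exact memLp_two_of_lintegral_sub_le
    (h.measurable_batchGrad_step measurable_const measurable_id).aestronglyMeasurable
    (gradient M.meanLoss w) (h.lintegral_batchGrad_step_sub_sq_le hn w)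

theorem integral_norm_batchGrad_step (h : M.Assumptions c) (hn : n.Admissible c) (w : Vec d) :
    ∫ s, ‖M.batchGrad s.1 w s.2‖ ∂(M.stepLaw n) =
      ∫ i, ∫ D : Fin n.Dβ → Θ, ‖M.batchGrad i w D‖ ∂(Measure.pi fun _ => M.ν i) ∂M.p := by
  have := h.prob_task
  have := h.isMarkovKernel_step (n := n)
  have := h.isProbabilityMeasure_stepLaw (n := n)
  exact Measure.integral_compProd ((h.memLp_batchGrad_step hn w).integrable (by norm_num)).norm

theorem norm_gradient_le_integral (h : M.Assumptions c) {m : ℕ} (hm : 0 < m) (i : ι) (w : Vec d) :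
    ‖gradient (M.f i) w‖ ≤
      ∫ D : Fin m → Θ, ‖M.batchGrad i w D‖ ∂(Measure.pi fun _ => M.ν i) := by
  rw [← h.integral_batchGrad hm]
  exact norm_integral_le_integral_norm _

theorem integral_norm_batchGrad_le (h : M.Assumptions c) {m : ℕ} (hm : 0 < m) (i : ι) (w : Vec d) :
    ∫ D : Fin m → Θ, ‖M.batchGrad i w D‖ ∂(Measure.pi fun _ => M.ν i) ≤
      ‖gradient (M.f i) w‖ + Real.sqrt (c.σt ^ 2 / m) := by
  have := h.prob_data i
  have hb := h.memLp_batchGrad (m := m) i w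
  have hb' : MemLp (fun D : Fin m → Θ => M.batchGrad i w D - gradient (M.f i) w) 2
    (Measure.pi fun _ => M.ν i) := hb.sub (memLp_const _)
  have hi := (hb'.integrable (by norm_num)).norm
  have h1 : ∫ D : Fin m → Θ, ‖M.batchGrad i w D - gradient (M.f i) w‖
      ∂(Measure.pi fun _ => M.ν i) ≤ Real.sqrt (c.σt ^ 2 / m) :=
    Real.le_sqrt_of_sq_le
      ((integral_sq_le_integral_sq hb'.norm).trans (h.integral_norm_batchGrad_sub_sq_le hm i w))
  calc _ ≤ ∫ D : Fin m → Θ, (‖gradient (M.f i) w‖ + ‖M.batchGrad i w D - gradient (M.f i) w‖)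
        ∂(Measure.pi fun _ => M.ν i) :=
        integral_mono (hb.integrable (by norm_num)).norm ((integrable_const _).add hi)
          fun D => norm_le_insert' _ _
    _ ≤ _ := by
        rw [integral_add (integrable_const _) hi]
        simpa using h1

theorem meanNorm_le_integral_step (h : M.Assumptions c) (hn : n.Admissible c) (w : Vec d) :
    M.meanNorm w ≤ ∫ s, ‖M.batchGrad s.1 w s.2‖ ∂(M.stepLaw n) ∧
    ∫ s, ‖M.batchGrad s.1 w s.2‖ ∂(M.stepLaw n) ≤
      M.meanNorm w + Real.sqrt (c.σt ^ 2 / n.Dβ) := by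
  have := h.prob_task
  have hg := h.integrable_norm_gradient w
  have hi : Integrable (fun i => ∫ D : Fin n.Dβ → Θ, ‖M.batchGrad i w D‖
      ∂(Measure.pi fun _ => M.ν i)) M.p := by
    refine (hg.add (integrable_const (Real.sqrt (c.σt ^ 2 / n.Dβ)))).mono'
      Measurable.of_discrete.aestronglyMeasurable (Filter.Eventually.of_forall fun i => ?_)
    rw [Real.norm_of_nonneg (integral_nonneg fun _ => norm_nonneg _)]
    exact h.integral_norm_batchGrad_le hn.Dβ_pos i w
  rw [h.integral_norm_batchGrad_step hn]
  refine ⟨integral_mono hg hi fun i => h.norm_gradient_le_integral hn.Dβ_pos i w, ?_⟩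
  refine (integral_mono hi (hg.add (integrable_const (Real.sqrt (c.σt ^ 2 / n.Dβ))))
    fun i => h.integral_norm_batchGrad_le hn.Dβ_pos i w).trans_eq ?_
  simp only [Pi.add_apply]
  rw [integral_add hg (integrable_const _)]
  simp [meanNorm]

theorem integral_norm_step_sub_sq_le (h : M.Assumptions c) (hn : n.Admissible c) (w : Vec d) :
    ∫ s, (‖M.batchGrad s.1 w s.2‖ - ∫ t, ‖M.batchGrad t.1 w t.2‖ ∂(M.stepLaw n)) ^ 2
      ∂(M.stepLaw n) ≤ c.σ ^ 2 + c.σt ^ 2 / n.Dβ := by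
  have := h.isProbabilityMeasure_stepLaw (n := n)
  have hb := h.memLp_batchGrad_step hn w
  have h1 := integral_norm_sub_integral_sq hb.norm ‖gradient M.meanLoss w‖
  simp only [Real.norm_eq_abs, sq_abs] at h1
  have hb' : MemLp (fun s : StepSample ι Θ n => M.batchGrad s.1 w s.2 - gradient M.meanLoss w) 2
    (M.stepLaw n) := hb.sub (memLp_const _)
  have h2 : ∫ s, (‖M.batchGrad s.1 w s.2‖ - ‖gradient M.meanLoss w‖) ^ 2 ∂(M.stepLaw n) ≤
      ∫ s, ‖M.batchGrad s.1 w s.2 - gradient M.meanLoss w‖ ^ 2 ∂(M.stepLaw n) := by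
    refine integral_mono_of_nonneg (Filter.Eventually.of_forall fun s => by positivity)
      ((memLp_two_iff_integrable_sq_norm hb'.1).1 hb') (Filter.Eventually.of_forall fun s => ?_)
    exact sq_le_sq.2 ((abs_norm_sub_norm_le _ _).trans (le_abs_self _))
  have h3 := integral_norm_sq_le_of_lintegral_le hb'.1 (by positivity)
    (h.lintegral_batchGrad_step_sub_sq_le hn w)
  nlinarith [sq_nonneg ((∫ t, ‖M.batchGrad t.1 w t.2‖ ∂(M.stepLaw n)) - ‖gradient M.meanLoss w‖)]

theorem measurable_Ltilde (h : M.Assumptions c) {X : Type*} [MeasurableSpace X] {f : X → Vec d}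
    {t : X → Fin n.B' → StepSample ι Θ n} (hf : Measurable f) (ht : Measurable t) :
    Measurable fun x => M.Ltilde c n (f x) (t x) := by
  unfold Ltilde
  have h1 : Measurable fun x => ∑ j, ‖M.batchGrad (t x j).1 (f x) (t x j).2‖ :=
    Finset.measurable_fun_sum _ fun j _ =>
      (h.measurable_batchGrad_step hf ((measurable_pi_apply j).comp ht)).norm
  exact (h1.const_mul _).const_add _

theorem measurable_stepsize (h : M.Assumptions c) {X : Type*} [MeasurableSpace X] {f : X → Vec d}
    {t : X → Fin n.B' → StepSample ι Θ n} (hf : Measurable f) (ht : Measurable t) :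
    Measurable fun x => M.stepsize c n (f x) (t x) :=
  ((h.measurable_Ltilde hf ht).const_div 1).div_const 12

theorem le_Ltilde (h : M.Assumptions c) (hα : 0 < c.α) (w : Vec d)
    (s : Fin n.B' → StepSample ι Θ n) : 4 * c.L ≤ M.Ltilde c n w s := by
  have := h.ρ_nonneg
  have : 0 ≤ 2 * c.ρ * c.α / n.B' * ∑ j, ‖M.batchGrad (s j).1 w (s j).2‖ := by positivity
  unfold Ltilde
  linarith

theorem le_smoothness (h : M.Assumptions c) (hα : 0 < c.α) (w : Vec d) :
    4 * c.L ≤ M.smoothness c w := by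
  have := h.ρ_nonneg
  have := meanNorm_nonneg (M := M) w
  have : 0 ≤ 2 * c.ρ * c.α * M.meanNorm w := by positivity
  unfold smoothness
  linarith

theorem lipBound_le (h : M.Assumptions c) (w : Vec d) :
    M.lipBound c w ≤ 7 / 12 * M.smoothness c w := by
  have := h.L_pos
  unfold lipBound smoothness
  linarith

theorem memLp_Ltilde (h : M.Assumptions c) (hn : n.Admissible c) (w : Vec d) :
    MemLp (M.Ltilde c n w) 2 (Measure.pi fun _ : Fin n.B' => M.stepLaw n) := by
  have := h.isProbabilityMeasure_stepLaw (n := n)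
  have h1 : MemLp (fun s : Fin n.B' → StepSample ι Θ n =>
      (n.B' : ℝ)⁻¹ • ∑ j, ‖M.batchGrad (s j).1 w (s j).2‖) 2
      (Measure.pi fun _ : Fin n.B' => M.stepLaw n) :=
    memLp_average (Y := fun s : StepSample ι Θ n => ‖M.batchGrad s.1 w s.2‖)
      (h.memLp_batchGrad_step hn w).norm
  have h2 : MemLp (fun _ : Fin n.B' → StepSample ι Θ n => 4 * c.L) 2
      (Measure.pi fun _ : Fin n.B' => M.stepLaw n) := memLp_const _
  refine (h2.add (h1.const_mul (2 * c.ρ * c.α))).ae_eq (Filter.Eventually.of_forall fun s => ?_)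
  simp only [Pi.add_apply, Ltilde, smul_eq_mul]
  ring

theorem integral_Ltilde (h : M.Assumptions c) (hn : n.Admissible c) (w : Vec d) :
    ∫ s, M.Ltilde c n w s ∂(Measure.pi fun _ : Fin n.B' => M.stepLaw n) =
      4 * c.L + 2 * c.ρ * c.α * ∫ s, ‖M.batchGrad s.1 w s.2‖ ∂(M.stepLaw n) := by
  have := h.isProbabilityMeasure_stepLaw (n := n)
  have hY := ((h.memLp_batchGrad_step hn w).integrable (by norm_num)).norm
  have h0 := integral_average (m := n.B') hY hn.B'_pos
  have h1 : Integrable (fun s : Fin n.B' → StepSample ι Θ n =>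
      (n.B' : ℝ)⁻¹ • ∑ j, ‖M.batchGrad (s j).1 w (s j).2‖)
      (Measure.pi fun _ : Fin n.B' => M.stepLaw n) :=
    (memLp_average (Y := fun s : StepSample ι Θ n => ‖M.batchGrad s.1 w s.2‖)
      (h.memLp_batchGrad_step hn w).norm).integrable (by norm_num)
  have e : ∀ s, M.Ltilde c n w s = 4 * c.L + 2 * c.ρ * c.α * ((n.B' : ℝ)⁻¹ •
      ∑ j, ‖M.batchGrad (s j).1 w (s j).2‖) := by
    intro s
    simp only [Ltilde, smul_eq_mul]
    ring
  simp_rw [e]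
  rw [integral_add (integrable_const _) (h1.const_mul _),
    integral_const_mul (2 * c.ρ * c.α), h0]
  simp

theorem sq_mul_variance_le {ρ σ L D : ℝ} (hL : 0 < L) {k : ℝ} (hk : 0 < k) (hD : 0 < D)
    (h : k * (ρ * σ / L) ^ 2 ≤ D) : ρ ^ 2 * (σ ^ 2 / D) ≤ L ^ 2 / k := by
  rw [div_pow, ← mul_div_assoc, div_le_iff₀ (by positivity)] at h
  rw [← mul_div_assoc, div_le_div_iff₀ hD hk]
  nlinarith

/-- The task variance contributes at most `4 · 2 L²` by the size of `B'`, the data variance at most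
`4 · L²/4` by the size of `Dβ`. -/
theorem integral_Ltilde_sub_sq_le (h : M.Assumptions c) (hn : n.Admissible c) (w : Vec d) :
    ∫ s, (M.Ltilde c n w s - ∫ t, M.Ltilde c n w t ∂(Measure.pi fun _ : Fin n.B' => M.stepLaw n)) ^ 2
      ∂(Measure.pi fun _ : Fin n.B' => M.stepLaw n) ≤ 9 * c.L ^ 2 := by
  have := h.isProbabilityMeasure_stepLaw (n := n)
  have hY := (h.memLp_batchGrad_step hn w).norm
  have h0 := integral_average_sub_sq (m := n.B') hY hn.B'_pos
  have h1 := h.integral_norm_step_sub_sq_le hn w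
  have e : ∀ s, (M.Ltilde c n w s -
        ∫ t, M.Ltilde c n w t ∂(Measure.pi fun _ : Fin n.B' => M.stepLaw n)) ^ 2 =
      4 * (c.ρ * c.α) ^ 2 * ((n.B' : ℝ)⁻¹ * ∑ j, ‖M.batchGrad (s j).1 w (s j).2‖ -
        ∫ t, ‖M.batchGrad t.1 w t.2‖ ∂(M.stepLaw n)) ^ 2 := by
    intro s
    rw [h.integral_Ltilde hn]
    simp only [Ltilde]
    ring
  simp_rw [e]
  rw [integral_const_mul, h0]
  have hB : (0 : ℝ) < n.B' := by exact_mod_cast hn.B'_pos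
  have hB1 : (1 : ℝ) ≤ n.B' := by exact_mod_cast hn.B'_pos
  have hD : (0 : ℝ) < n.Dβ := by exact_mod_cast hn.Dβ_pos
  have hB2 : (1 / 2 : ℝ) * (c.ρ * c.α * c.σ / c.L) ^ 2 ≤ n.B' := Nat.ceil_le.1 hn.B'_ge
  have hD2 : 4 * (c.ρ * c.α * c.σt / c.L) ^ 2 ≤ n.Dβ := by
    have : (2 * c.ρ * c.α * c.σt / c.L) ^ 2 ≤ n.Dβ := Nat.ceil_le.1 hn.Dβ_ge
    calc _ = (2 * c.ρ * c.α * c.σt / c.L) ^ 2 := by ring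
      _ ≤ _ := this
  have k1 := sq_mul_variance_le h.L_pos (by norm_num) hB hB2
  have k2 := sq_mul_variance_le h.L_pos (by norm_num) hD hD2
  have k3 : (c.ρ * c.α) ^ 2 * (c.σt ^ 2 / n.Dβ) / n.B' ≤
      (c.ρ * c.α) ^ 2 * (c.σt ^ 2 / n.Dβ) := div_le_self (by positivity) hB1
  calc _ ≤ 4 * (c.ρ * c.α) ^ 2 * ((c.σ ^ 2 + c.σt ^ 2 / n.Dβ) / n.B') := by gcongr
    _ = 4 * ((c.ρ * c.α) ^ 2 * (c.σ ^ 2 / n.B')) +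
        4 * ((c.ρ * c.α) ^ 2 * (c.σt ^ 2 / n.Dβ) / n.B') := by ring
    _ ≤ _ := by linarith

/-- The norm of an unbiased estimate has mean at least the true norm, which gives the lower bound.
For the upper one, the excess `2ρα √(σt²/Dβ)` is at most `L`, hence at most a quarter of
`smoothness`. -/
theorem smoothness_le_integral (h : M.Assumptions c) (hα : 0 < c.α) (hn : n.Admissible c)
    (w : Vec d) :
    M.smoothness c w ≤ ∫ s, M.Ltilde c n w s ∂(Measure.pi fun _ : Fin n.B' => M.stepLaw n) ∧
    ∫ s, M.Ltilde c n w s ∂(Measure.pi fun _ : Fin n.B' => M.stepLaw n) ≤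
      5 / 4 * M.smoothness c w := by
  obtain ⟨h1, h2⟩ := h.meanNorm_le_integral_step hn w
  have hρ := h.ρ_nonneg
  have hL := h.L_pos
  have hσ := h.σt_nonneg
  rw [h.integral_Ltilde hn]
  have hD : (0 : ℝ) < n.Dβ := by exact_mod_cast hn.Dβ_pos
  have hD2 : 4 * (c.ρ * c.α * c.σt / c.L) ^ 2 ≤ n.Dβ := by
    have : (2 * c.ρ * c.α * c.σt / c.L) ^ 2 ≤ n.Dβ := Nat.ceil_le.1 hn.Dβ_ge
    calc _ = (2 * c.ρ * c.α * c.σt / c.L) ^ 2 := by ring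
      _ ≤ _ := this
  have k2 := sq_mul_variance_le h.L_pos (by norm_num) hD hD2
  have k3 : c.ρ * c.α * Real.sqrt (c.σt ^ 2 / n.Dβ) ≤ c.L / 2 := by
    refine abs_le_of_sq_le_sq' ?_ (by positivity) |>.2
    rw [mul_pow, Real.sq_sqrt (by positivity)]
    linarith
  have k4 := mul_le_mul_of_nonneg_left h1 (by positivity : 0 ≤ 2 * c.ρ * c.α)
  have k5 := mul_le_mul_of_nonneg_left h2 (by positivity : 0 ≤ 2 * c.ρ * c.α)
  have k6 := h.le_smoothness hα w
  unfold smoothness at k6 ⊢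
  constructor <;> nlinarith

theorem stepsize_nonneg (h : M.Assumptions c) (hα : 0 < c.α) (w : Vec d)
    (s : Fin n.B' → StepSample ι Θ n) : 0 ≤ M.stepsize c n w s := by
  have := h.le_Ltilde hα w s
  have := h.L_pos
  have : 0 < M.Ltilde c n w s := by linarith
  unfold stepsize
  positivity

theorem stepsize_le (h : M.Assumptions c) (hα : 0 < c.α) (w : Vec d)
    (s : Fin n.B' → StepSample ι Θ n) : M.stepsize c n w s ≤ 1 / (4 * c.L) / 12 := by
  have := h.le_Ltilde hα w s
  have := h.L_pos
  unfold stepsize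
  gcongr

theorem integrable_stepsize (h : M.Assumptions c) (hα : 0 < c.α) (w : Vec d) :
    Integrable (M.stepsize c n w) (Measure.pi fun _ : Fin n.B' => M.stepLaw n) := by
  have := h.isProbabilityMeasure_stepLaw (n := n)
  refine (integrable_const (1 / (4 * c.L) / 12)).mono'
    (h.measurable_stepsize measurable_const measurable_id).aestronglyMeasurable
    (Filter.Eventually.of_forall fun s => ?_)
  rw [Real.norm_of_nonneg (h.stepsize_nonneg hα w s)]
  exact h.stepsize_le hα w s

theorem integrable_stepsize_sq (h : M.Assumptions c) (hα : 0 < c.α) (w : Vec d) :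
    Integrable (fun s => M.stepsize c n w s ^ 2)
      (Measure.pi fun _ : Fin n.B' => M.stepLaw n) := by
  have := h.isProbabilityMeasure_stepLaw (n := n)
  refine (integrable_const ((1 / (4 * c.L) / 12) ^ 2)).mono'
    ((h.measurable_stepsize measurable_const measurable_id).pow_const 2).aestronglyMeasurable
    (Filter.Eventually.of_forall fun s => ?_)
  rw [Real.norm_of_nonneg (sq_nonneg _)]
  exact pow_le_pow_left₀ (h.stepsize_nonneg hα w s) (h.stepsize_le hα w s) 2

theorem two_div_sub_le_one_div {a z : ℝ} (ha : 0 < a) (hz : 0 < z) :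
    2 / a - z / a ^ 2 ≤ 1 / z := by
  have e : 1 / z - (2 / a - z / a ^ 2) = (a - z) ^ 2 / (z * a ^ 2) := by
    field_simp
    ring
  have : 0 ≤ (a - z) ^ 2 / (z * a ^ 2) := by positivity
  linarith

/-- Jensen for `z ↦ 1/z`, by integrating its tangent line at the mean `a` of `Ltilde`: `E β ≥ 1/(12
a)`, and `12 · 5/4 = 15`. -/
theorem le_integral_stepsize (h : M.Assumptions c) (hα : 0 < c.α) (hn : n.Admissible c)
    (w : Vec d) :
    1 / (15 * M.smoothness c w) ≤
      ∫ s, M.stepsize c n w s ∂(Measure.pi fun _ : Fin n.B' => M.stepLaw n) := by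
  have := h.isProbabilityMeasure_stepLaw (n := n)
  obtain ⟨h1, h2⟩ := h.smoothness_le_integral hα hn w
  have h3 := h.le_smoothness hα w
  have hL := h.L_pos
  set a := ∫ s, M.Ltilde c n w s ∂(Measure.pi fun _ : Fin n.B' => M.stepLaw n)
  have ha : 0 < a := by linarith
  have hZ : Integrable (M.Ltilde c n w) (Measure.pi fun _ : Fin n.B' => M.stepLaw n) :=
    (h.memLp_Ltilde hn w).integrable (by norm_num)
  have hlow : ∀ s, (2 / a - M.Ltilde c n w s / a ^ 2) / 12 ≤ M.stepsize c n w s := by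
    intro s
    have hs : 0 < M.Ltilde c n w s := by linarith [h.le_Ltilde hα w s]
    unfold stepsize
    exact div_le_div_of_nonneg_right (two_div_sub_le_one_div ha hs) (by norm_num)
  calc 1 / (15 * M.smoothness c w) ≤ 1 / (12 * a) := by
        have : 0 < M.smoothness c w := by linarith
        exact one_div_le_one_div_of_le (by positivity) (by linarith)
    _ = ∫ s, (2 / a - M.Ltilde c n w s / a ^ 2) / 12
        ∂(Measure.pi fun _ : Fin n.B' => M.stepLaw n) := by
        rw [integral_div, integral_sub (integrable_const _) (hZ.div_const _),
          integral_div (a ^ 2)]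
        simp only [integral_const, probReal_univ, one_smul]
        change _ = (2 / a - a / a ^ 2) / 12
        field_simp
        norm_num
    _ ≤ _ := integral_mono (((integrable_const _).sub (hZ.div_const _)).div_const _)
        (h.integrable_stepsize hα w) hlow

/-- The deterministic floor `4L` of `Ltilde` limits the effect of underestimation. With `(1 + t)² ≤
2 + 2t²` and variance at most `9 L²`, the ratio `(l/z)²` has mean at most `2 + 9/8 = 25/8`, and
`25/8/144 = 25/1152`. -/
theorem integral_stepsize_sq_le (h : M.Assumptions c) (hα : 0 < c.α) (hn : n.Admissible c)
    (w : Vec d) :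
    ∫ s, M.stepsize c n w s ^ 2 ∂(Measure.pi fun _ : Fin n.B' => M.stepLaw n) ≤
      25 / 1152 / M.smoothness c w ^ 2 := by
  have := h.isProbabilityMeasure_stepLaw (n := n)
  obtain ⟨h1, -⟩ := h.smoothness_le_integral hα hn w
  have h3 := h.le_smoothness hα w
  have hL := h.L_pos
  have h4 := h.integral_Ltilde_sub_sq_le hn w
  set a := ∫ s, M.Ltilde c n w s ∂(Measure.pi fun _ : Fin n.B' => M.stepLaw n)
  set l := M.smoothness c w
  have hl : 0 < l := by linarith
  have hV : Integrable (fun s => (M.Ltilde c n w s - a) ^ 2)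
      (Measure.pi fun _ : Fin n.B' => M.stepLaw n) :=
    ((h.memLp_Ltilde hn w).sub (memLp_const a)).integrable_sq
  have hup : ∀ s, M.stepsize c n w s ^ 2 ≤
      (2 + 1 / (8 * c.L ^ 2) * (M.Ltilde c n w s - a) ^ 2) * (1 / (144 * l ^ 2)) := by
    intro s
    have h5 := h.le_Ltilde hα w s
    unfold stepsize
    set z := M.Ltilde c n w s
    have hz : 0 < z := by linarith
    -- `l ≤ a ≤ z + |z - a|`, divided by `z ≥ 4L`.
    have h6 : l / z ≤ 1 + |z - a| / (4 * c.L) := by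
      rw [div_le_iff₀ hz]
      have : |z - a| ≤ |z - a| / (4 * c.L) * z := by
        rw [div_mul_eq_mul_div, le_div_iff₀ (by positivity)]
        exact mul_le_mul_of_nonneg_left h5 (abs_nonneg _)
      have := neg_abs_le (z - a)
      nlinarith
    have h7 := pow_le_pow_left₀ (by positivity) h6 2
    have h8 : (1 + |z - a| / (4 * c.L)) ^ 2 ≤ 2 + 1 / (8 * c.L ^ 2) * (z - a) ^ 2 := by
      have e : 1 / (8 * c.L ^ 2) * (z - a) ^ 2 = 2 * (|z - a| / (4 * c.L)) ^ 2 := by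
        rw [div_pow, sq_abs]
        field_simp
        ring
      rw [e]
      nlinarith [sq_nonneg (1 - |z - a| / (4 * c.L))]
    calc (1 / z / 12) ^ 2 = (l / z) ^ 2 * (1 / (144 * l ^ 2)) := by field_simp; norm_num
      _ ≤ _ := by gcongr; exact h7.trans h8
  calc _ ≤ ∫ s, (2 + 1 / (8 * c.L ^ 2) * (M.Ltilde c n w s - a) ^ 2) * (1 / (144 * l ^ 2))
        ∂(Measure.pi fun _ : Fin n.B' => M.stepLaw n) :=
        integral_mono (h.integrable_stepsize_sq hα w)
          (((integrable_const _).add (hV.const_mul _)).mul_const _) hup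
    _ = (2 + 1 / (8 * c.L ^ 2) * ∫ s, (M.Ltilde c n w s - a) ^ 2
        ∂(Measure.pi fun _ : Fin n.B' => M.stepLaw n)) * (1 / (144 * l ^ 2)) := by
        rw [integral_mul_const, integral_add (integrable_const _) (hV.const_mul _),
          integral_const_mul]
        simp
    _ ≤ (2 + 1 / (8 * c.L ^ 2) * (9 * c.L ^ 2)) * (1 / (144 * l ^ 2)) := by gcongr
    _ = _ := by field_simp; norm_num

end Law

end Assumptions
end Model
end MAML
end

/-! ### Expected decrease of the objective in one iteration. -/

noncomputable section
namespace MAML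
namespace Model

variable {d : ℕ} {ι : Type u} {Θ : Type v} [MeasurableSpace ι] [MeasurableSpace Θ]
  {M : Model d ι Θ} {c : Constants} {n : BatchSizes}

/-- The guaranteed expected decrease of the objective in one iteration, up to noise. -/
def progress (M : Model d ι Θ) (c : Constants) (w : Vec d) : ℝ :=
  ‖gradient (M.F c.α) w‖ ^ 2 / (240 * (c.L + c.ρ * c.α * (c.σ + ‖gradient (M.F c.α) w‖)))

theorem step_eq (w : Vec d) (x : Block ι Θ n) :
    M.step c n w x =
      w - M.stepsize c n w x.2 • ((n.B : ℝ)⁻¹ • ∑ b, M.direction c.α n w (x.1 b)) := by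
  rw [step, smul_smul, div_eq_mul_inv]

namespace Assumptions

section Law

variable [Countable ι] [DiscreteMeasurableSpace ι]

theorem isProbabilityMeasure_blockLaw (h : M.Assumptions c) :
    IsProbabilityMeasure (M.blockLaw n) := by
  have := h.isProbabilityMeasure_taskLaw (n := n)
  have := h.isProbabilityMeasure_stepLaw (n := n)
  unfold blockLaw
  infer_instance

theorem measurable_step (h : M.Assumptions c) :
    Measurable fun y : Vec d × Block ι Θ n => M.step c n y.1 y.2 := by
  have h1 : Measurable fun y : Vec d × Block ι Θ n => M.stepsize c n y.1 y.2.2 :=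
    h.measurable_stepsize measurable_fst measurable_snd.snd
  have h2 : Measurable fun y : Vec d × Block ι Θ n =>
      ∑ b, M.direction c.α n y.1 (y.2.1 b) :=
    Finset.measurable_fun_sum _ fun b _ => h.measurable_direction c.α measurable_fst
      ((measurable_pi_apply b).comp measurable_snd.fst)
  exact measurable_fst.sub ((h1.div_const (n.B : ℝ)).smul h2)

theorem abs_F_step_sub_le (h : M.Assumptions c) (hα : 0 < c.α) (hαL : c.α * c.L ≤ 1 / 6) (w : Vec d)
    (x : Block ι Θ n) :
    |M.F c.α (M.step c n w x) - M.F c.α w +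
      inner ℝ (gradient (M.F c.α) w) ((n.B : ℝ)⁻¹ • ∑ b, M.direction c.α n w (x.1 b)) *
        M.stepsize c n w x.2| ≤
    M.lipBound c w * (‖(n.B : ℝ)⁻¹ • ∑ b, M.direction c.α n w (x.1 b)‖ ^ 2 *
      M.stepsize c n w x.2 ^ 2) := by
  have h1 := h.abs_F_sub_sub_inner_le hα hαL w (M.step c n w x)
  rw [step_eq] at h1 ⊢
  rw [sub_sub_cancel_left, inner_neg_right, real_inner_smul_right, norm_neg, norm_smul, mul_pow,
    Real.norm_eq_abs, sq_abs, sub_neg_eq_add] at h1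
  rw [mul_comm (inner ℝ _ _), mul_comm (‖_‖ ^ 2)]
  exact h1

/-- The tasks that determine the stepsize are independent of those that determine the direction, so
the expectation of each product factors. Integrability of `F` after the step follows from the
two-sided quadratic bound. -/
theorem integrable_F_step (h : M.Assumptions c) (hα : 0 < c.α) (hαL : c.α * c.L ≤ 1 / 6)
    (hn : n.Admissible c) (w : Vec d) :
    Integrable (fun x => M.F c.α (M.step c n w x)) (M.blockLaw n) ∧
    ∫ x, M.F c.α (M.step c n w x) ∂(M.blockLaw n) ≤ M.F c.α w -
      inner ℝ (gradient (M.F c.α) w) (∫ t, M.direction c.α n w t ∂(M.taskLaw n)) *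
        ∫ s, M.stepsize c n w s ∂(Measure.pi fun _ : Fin n.B' => M.stepLaw n) +
      M.lipBound c w * ((‖∫ t, M.direction c.α n w t ∂(M.taskLaw n)‖ ^ 2 +
        M.directionBound c n w / n.B) *
        ∫ s, M.stepsize c n w s ^ 2 ∂(Measure.pi fun _ : Fin n.B' => M.stepLaw n)) := by
  have := h.isProbabilityMeasure_taskLaw (n := n)
  have := h.isProbabilityMeasure_stepLaw (n := n)
  have := h.isProbabilityMeasure_blockLaw (n := n)
  set μ := Measure.pi fun _ : Fin n.B => M.taskLaw n with hμ
  set ν := Measure.pi fun _ : Fin n.B' => M.stepLaw n with hν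
  set g := gradient (M.F c.α) w
  let G : (Fin n.B → TaskSample ι Θ n) → Vec d := fun x =>
    (n.B : ℝ)⁻¹ • ∑ b, M.direction c.α n w (x b)
  have hG : MemLp G 2 μ := h.memLp_batch_direction hα hαL hn w
  have hGi : Integrable G μ := hG.integrable (by norm_num)
  have hG2 : Integrable (fun x => ‖G x‖ ^ 2) μ := (memLp_two_iff_integrable_sq_norm hG.1).1 hG
  have hgG : Integrable (fun x => inner ℝ g (G x)) μ := hGi.const_inner g
  have hβ : Integrable (M.stepsize c n w) ν := h.integrable_stepsize hα w
  have hβ2 : Integrable (fun s => M.stepsize c n w s ^ 2) ν := h.integrable_stepsize_sq hα w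
  have i1 : Integrable (fun x : Block ι Θ n => inner ℝ g (G x.1) * M.stepsize c n w x.2)
      (μ.prod ν) := hgG.mul_prod hβ
  have i2 : Integrable (fun x : Block ι Θ n => M.lipBound c w * (‖G x.1‖ ^ 2 *
      M.stepsize c n w x.2 ^ 2)) (μ.prod ν) := (hG2.mul_prod hβ2).const_mul _
  have hmeas : Measurable fun x : Block ι Θ n => M.F c.α (M.step c n w x) :=
    (h.differentiable_F hα hαL).continuous.measurable.comp
      (h.measurable_step.comp measurable_prodMk_left)
  have hb := fun x : Block ι Θ n => h.abs_F_step_sub_le hα hαL w x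
  change Integrable _ (μ.prod ν) ∧ ∫ x, _ ∂(μ.prod ν) ≤ _
  have i3 : Integrable (fun x : Block ι Θ n => M.F c.α (M.step c n w x) - M.F c.α w +
      inner ℝ g (G x.1) * M.stepsize c n w x.2) (μ.prod ν) :=
    i2.mono' ((hmeas.aestronglyMeasurable.sub aestronglyMeasurable_const).add i1.1)
      (Filter.Eventually.of_forall hb)
  have i4 : Integrable (fun x : Block ι Θ n => M.F c.α (M.step c n w x)) (μ.prod ν) := by
    refine ((i3.sub i1).add (integrable_const (M.F c.α w))).congr
      (Filter.Eventually.of_forall fun x => ?_)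
    simp
  refine ⟨i4, ?_⟩
  have i5 : Integrable (fun x : Block ι Θ n => M.F c.α w -
      inner ℝ g (G x.1) * M.stepsize c n w x.2) (μ.prod ν) := (integrable_const _).sub i1
  have h1 : ∫ x, M.F c.α (M.step c n w x) ∂(μ.prod ν) ≤
      ∫ x : Block ι Θ n, (M.F c.α w - inner ℝ g (G x.1) * M.stepsize c n w x.2 +
        M.lipBound c w * (‖G x.1‖ ^ 2 * M.stepsize c n w x.2 ^ 2)) ∂(μ.prod ν) := by
    refine integral_mono i4 (i5.add i2) fun x => ?_
    have := (abs_le.1 (hb x)).2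
    dsimp only [g, G]
    linarith
  rw [integral_add i5 i2, integral_sub (integrable_const _) i1, integral_const_mul,
    integral_prod_mul (fun x => inner ℝ g (G x)) (M.stepsize c n w),
    integral_prod_mul (fun x => ‖G x‖ ^ 2) (fun s => M.stepsize c n w s ^ 2),
    integral_inner hGi] at h1
  have h2 : ∫ x, G x ∂μ = ∫ t, M.direction c.α n w t ∂(M.taskLaw n) :=
    h.integral_batch_direction hα hαL hn w
  have h3 : ∫ x, ‖G x‖ ^ 2 ∂μ ≤ ‖∫ t, M.direction c.α n w t ∂(M.taskLaw n)‖ ^ 2 +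
    M.directionBound c n w / n.B := h.integral_norm_batch_direction_sq_le hα hαL hn w
  rw [h2] at h1
  simp only [integral_const, probReal_univ, one_smul] at h1
  refine h1.trans ?_
  have := h.lipBound_nonneg hα w
  have : 0 ≤ ∫ s, M.stepsize c n w s ^ 2 ∂ν := integral_nonneg fun _ => sq_nonneg _
  gcongr

/-- Collects the variance and bias terms with the weights they receive in `integral_F_step_le`:
`175/13824 = 7/12 · 25/1152` for the quadratic term, and `3/40`, half of the upper bound `3/20` for
`l E β`. The requirement `B ≥ 20` makes the share of `‖∇F‖²` at most `1/60`. -/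
theorem directionBound_div_le (h : M.Assumptions c) (hα : 0 < c.α) (hαL : c.α * c.L ≤ 1 / 6)
    (hn : n.Admissible c) (w : Vec d) :
    175 / 13824 * (M.directionBound c n w / n.B) + 3 / 40 * (49 / 1296 * (c.σt ^ 2 / n.Din)) ≤
      1 / 60 * ‖gradient (M.F c.α) w‖ ^ 2 + 11 / 100 * noiseLevel c n := by
  have hB20 : (20 : ℝ) ≤ n.B := by exact_mod_cast hn.B_ge
  have hB : (0 : ℝ) < n.B := by linarith
  have hDo : (0 : ℝ) < n.Do := by exact_mod_cast hn.Do_pos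
  have hf := h.norm_gradient_meanLoss_le hα hαL w
  set D := ‖gradient (M.F c.α) w‖
  have hf2 : ‖gradient M.meanLoss w‖ ^ 2 ≤ 2 * (36 / 23) ^ 2 * D ^ 2 + 2 * (13 / 23) ^ 2 * c.σ ^ 2 := by
    have := pow_le_pow_left₀ (norm_nonneg _) hf 2
    nlinarith [sq_nonneg (36 / 23 * D - 13 / 23 * c.σ)]
  have e : M.directionBound c n w / n.B = 67 / 36 * (49 / 18 * (‖gradient M.meanLoss w‖ ^ 2 / n.B +
      c.σ ^ 2 / n.B) + 1 / 18 * (c.σt ^ 2 / n.Din / n.B) + c.σt ^ 2 / (n.B * n.Do)) := by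
    unfold directionBound
    field_simp
  have h1 : ‖gradient M.meanLoss w‖ ^ 2 / n.B ≤
      2 * (36 / 23) ^ 2 * (D ^ 2 / 20) + 2 * (13 / 23) ^ 2 * (c.σ ^ 2 / n.B) := by
    calc _ ≤ (2 * (36 / 23) ^ 2 * D ^ 2 + 2 * (13 / 23) ^ 2 * c.σ ^ 2) / n.B := by gcongr
      _ = 2 * (36 / 23) ^ 2 * (D ^ 2 / n.B) + 2 * (13 / 23) ^ 2 * (c.σ ^ 2 / n.B) := by ring
      _ ≤ _ := by gcongr
  have h2 : c.σt ^ 2 / n.Din / n.B ≤ c.σt ^ 2 / n.Din := div_le_self (by positivity) (by linarith)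
  have p1 : 0 ≤ c.σ ^ 2 / n.B := by positivity
  have p2 : 0 ≤ c.σt ^ 2 / (n.B * n.Do) := by positivity
  have p3 : 0 ≤ c.σt ^ 2 / n.Din := by positivity
  rw [e, noiseLevel]
  nlinarith [sq_nonneg D]

theorem integral_F_step_le (h : M.Assumptions c) (hα : 0 < c.α) (hαL : c.α * c.L ≤ 1 / 6)
    (hn : n.Admissible c) (w : Vec d) :
    ∫ x, M.F c.α (M.step c n w x) ∂(M.blockLaw n) ≤ M.F c.α w -
      (1 / 60 * ‖gradient (M.F c.α) w‖ ^ 2 - 11 / 100 * noiseLevel c n) / M.smoothness c w := by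
  have := h.isProbabilityMeasure_stepLaw (n := n)
  refine (h.integrable_F_step hα hαL hn w).2.trans ?_
  have hL := h.L_pos
  have hlip := h.lipBound_le w
  have hlip0 := h.lipBound_nonneg hα w
  have hb1 := h.le_integral_stepsize hα hn w
  have hb2 := h.integral_stepsize_sq_le hα hn w
  have hmem : MemLp (M.stepsize c n w) 2 (Measure.pi fun _ : Fin n.B' => M.stepLaw n) :=
    (memLp_two_iff_integrable_sq (h.integrable_stepsize hα w).1).2 (h.integrable_stepsize_sq hα w)
  have hb3 := integral_sq_le_integral_sq hmem
  have hsm : 0 < M.smoothness c w := by linarith [h.le_smoothness hα w]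
  have hbias := h.norm_integral_direction_sub_sq_le hα hαL hn w
  have hnum := h.directionBound_div_le hα hαL hn w
  have hV : 0 ≤ M.directionBound c n w / n.B := by
    have := directionBound_nonneg (M := M) (c := c) (n := n) w
    positivity
  rw [norm_sub_sq_real, real_inner_comm] at hbias
  set l := M.smoothness c w
  set b := ∫ s, M.stepsize c n w s ∂(Measure.pi fun _ : Fin n.B' => M.stepLaw n)
  set b2 := ∫ s, M.stepsize c n w s ^ 2 ∂(Measure.pi fun _ : Fin n.B' => M.stepLaw n)
  set m := ∫ t, M.direction c.α n w t ∂(M.taskLaw n)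
  set g := gradient (M.F c.α) w
  set V := M.directionBound c n w / n.B
  set q := inner ℝ g m
  set τ := c.σt ^ 2 / n.Din
  have hτ : 0 ≤ τ := by positivity
  -- `(E β)² ≤ E β² ≤ (25/1152)/l²`, and `25/1152 < (3/20)²`.
  have hb4 : b ≤ 3 / 20 / l := by
    refine abs_le_of_sq_le_sq' ?_ (by positivity) |>.2
    refine (hb3.trans hb2).trans ?_
    rw [div_pow]
    gcongr
    norm_num
  have hb0 : 0 ≤ b := le_trans (by positivity) hb1
  have k1 : M.lipBound c w * ((‖m‖ ^ 2 + V) * b2) ≤ 175 / 13824 / l * (‖m‖ ^ 2 + V) := by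
    calc _ ≤ 7 / 12 * l * ((‖m‖ ^ 2 + V) * (25 / 1152 / l ^ 2)) := by gcongr
      _ = _ := by field_simp; ring
  have k2 : 1 / 15 / l ≤ b := by
    calc 1 / 15 / l = 1 / (15 * l) := by field_simp
      _ ≤ _ := hb1
  -- Polarization: `2⟨g, m⟩ = ‖m‖² + ‖g‖² - ‖m - g‖²`, where the last term is the squared bias. The
  -- useful part is kept with the lower bound on `b`, the bias with the upper bound.
  have k3 : q * b ≥ b / 2 * (‖m‖ ^ 2 + ‖g‖ ^ 2 - 49 / 1296 * τ) := by
    nlinarith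
  have k4 : b / 2 * (‖m‖ ^ 2 + ‖g‖ ^ 2) ≥ 1 / 15 / l / 2 * (‖m‖ ^ 2 + ‖g‖ ^ 2) := by gcongr
  have k5 : b / 2 * (49 / 1296 * τ) ≤ 3 / 20 / l / 2 * (49 / 1296 * τ) := by gcongr
  have k6 : 0 ≤ 1 / l * (1 / 30 * (‖m‖ ^ 2 + ‖g‖ ^ 2) - 3 / 40 * (49 / 1296 * τ) -
      175 / 13824 * (‖m‖ ^ 2 + V) - (1 / 60 * ‖g‖ ^ 2 - 11 / 100 * noiseLevel c n)) := by
    apply mul_nonneg (by positivity)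
    -- The term `‖m‖²` drops out because `1/30 > 175/13824`. Of the `1/30` in front of `‖g‖²`, half
    -- pays for the variance through `hnum` and half is the gain.
    nlinarith [sq_nonneg ‖m‖]
  have k7 : (1 / 60 * ‖g‖ ^ 2 - 11 / 100 * noiseLevel c n) / l =
    1 / l * (1 / 60 * ‖g‖ ^ 2 - 11 / 100 * noiseLevel c n) := by ring
  have k8 : 1 / 15 / l / 2 * (‖m‖ ^ 2 + ‖g‖ ^ 2) - 3 / 20 / l / 2 * (49 / 1296 * τ) -
      175 / 13824 / l * (‖m‖ ^ 2 + V) = 1 / l * (1 / 30 * (‖m‖ ^ 2 + ‖g‖ ^ 2) -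
      3 / 40 * (49 / 1296 * τ) - 175 / 13824 * (‖m‖ ^ 2 + V)) := by ring
  rw [k7]
  linarith

theorem noiseLevel_nonneg : 0 ≤ noiseLevel c n := by
  unfold noiseLevel
  positivity

theorem smoothness_le_gradient_F (h : M.Assumptions c) (hα : 0 < c.α)
    (hαL : c.α * c.L ≤ 1 / 6) (w : Vec d) :
    M.smoothness c w ≤ 4 * (c.L + c.ρ * c.α * (c.σ + ‖gradient (M.F c.α) w‖)) := by
  have h1 := h.meanNorm_le_gradient_F hα hαL w
  have hρ := h.ρ_nonneg
  have hσ := h.σ_pos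
  have h2 := mul_le_mul_of_nonneg_left h1 (by positivity : 0 ≤ 2 * c.ρ * c.α)
  have h3 : 0 ≤ c.ρ * c.α * (c.σ + ‖gradient (M.F c.α) w‖) := by positivity
  unfold smoothness
  nlinarith

/-- `smoothness` is bounded in opposite directions: from above in terms of `‖∇F(w)‖` in the gain
(`60 · 4 = 240`), from below by `4L` in the noise (`11/100/4 = 11/400`). -/
theorem integral_F_step_add_progress_le (h : M.Assumptions c) (hα : 0 < c.α)
    (hαL : c.α * c.L ≤ 1 / 6) (hn : n.Admissible c) (w : Vec d) :
    ∫ x, M.F c.α (M.step c n w x) ∂(M.blockLaw n) + M.progress c w ≤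
      M.F c.α w + 11 / 400 * (noiseLevel c n / c.L) := by
  have h1 := h.integral_F_step_le hα hαL hn w
  have hL := h.L_pos
  have h2 := h.le_smoothness hα w
  have h3 := h.smoothness_le_gradient_F hα hαL w
  have hs := noiseLevel_nonneg (c := c) (n := n)
  have hl : 0 < M.smoothness c w := by linarith
  have h4 : M.progress c w ≤ 1 / 60 * ‖gradient (M.F c.α) w‖ ^ 2 / M.smoothness c w := by
    calc _ = 1 / 60 * ‖gradient (M.F c.α) w‖ ^ 2 /
          (4 * (c.L + c.ρ * c.α * (c.σ + ‖gradient (M.F c.α) w‖))) := by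
          have hy : c.L + c.ρ * c.α * (c.σ + ‖gradient (M.F c.α) w‖) ≠ 0 := by
            intro h0
            rw [h0] at h3
            linarith
          unfold progress
          field_simp
          ring
      _ ≤ _ := by gcongr
  have h5 : 11 / 100 * noiseLevel c n / M.smoothness c w ≤ 11 / 400 * (noiseLevel c n / c.L) := by
    calc _ ≤ 11 / 100 * noiseLevel c n / (4 * c.L) := by gcongr
      _ = _ := by ring
  rw [sub_div] at h1
  linarith

end Law

end Assumptions
end Model
end MAML
end

/-! ### Descent along the iterates and the stopping argument. -/

noncomputable section
namespace MAML

/-- The tangent-line bound for the convex function `x ↦ x² / (A + B x)`. -/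
theorem tangent_le_sq_div {A B x t : ℝ} (h : 0 < A + B * x) :
    x * (2 * t - t ^ 2 * B) - t ^ 2 * A ≤ x ^ 2 / (A + B * x) := by
  rw [le_div_iff₀ h]
  nlinarith [sq_nonneg (x - t * (A + B * x))]

theorem sq_div_mono {A B x y : ℝ} (hA : 0 < A) (hB : 0 ≤ B) (hx : 0 ≤ x) (hxy : x ≤ y) :
    x ^ 2 / (A + B * x) ≤ y ^ 2 / (A + B * y) := by
  have hy : 0 ≤ y := hx.trans hxy
  rw [div_le_div_iff₀ (by positivity) (by positivity)]
  nlinarith [mul_nonneg hA.le (mul_nonneg (sub_nonneg.2 hxy) (add_nonneg hx hy)),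
    mul_nonneg (mul_nonneg hB (mul_nonneg hx hy)) (sub_nonneg.2 hxy)]

namespace Model

variable {d : ℕ} {ι : Type u} {Θ : Type v} [MeasurableSpace ι] [MeasurableSpace Θ]
  [Countable ι] [DiscreteMeasurableSpace ι] {M : Model d ι Θ} {c : Constants} {n : BatchSizes}
  {Ω : Type w} [MeasurableSpace Ω] {P : Measure Ω} {ξ : ℕ → Ω → Block ι Θ n}

namespace Assumptions

/-- Only the samples with index below `k` enter; this is what makes the iterate independent of `ξ
k`. -/
theorem exists_measurable_iterate (h : M.Assumptions c) (w₀ : Vec d) (ξ : ℕ → Ω → Block ι Θ n)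
    (k : ℕ) :
    ∃ Φ : (Finset.range k → Block ι Θ n) → Vec d, Measurable Φ ∧
      ∀ ω, M.iterate c n w₀ ξ k ω = Φ fun j => ξ j ω := by
  induction k with
  | zero => exact ⟨fun _ => w₀, measurable_const, fun _ => rfl⟩
  | succ k ih =>
    obtain ⟨Φ, hΦ, e⟩ := ih
    let r : Finset.range k → Finset.range (k + 1) := fun j =>
      ⟨j, Finset.mem_range.2 (Nat.lt_succ_of_lt (Finset.mem_range.1 j.2))⟩
    let l : Finset.range (k + 1) := ⟨k, Finset.self_mem_range_succ k⟩
    refine ⟨fun x => M.step c n (Φ fun j => x (r j)) (x l), ?_, fun ω => ?_⟩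
    · have h1 : Measurable fun x : Finset.range (k + 1) → Block ι Θ n => fun j => x (r j) :=
        measurable_pi_lambda _ fun j => measurable_pi_apply (r j)
      exact h.measurable_step.comp ((hΦ.comp h1).prodMk (measurable_pi_apply l))
    · rw [iterate, e]

theorem aemeasurable_iterate (h : M.Assumptions c) (hξ : M.IsSampling n P ξ) (w₀ : Vec d)
    (k : ℕ) : AEMeasurable (M.iterate c n w₀ ξ k) P := by
  obtain ⟨Φ, hΦ, e⟩ := h.exists_measurable_iterate w₀ ξ k
  rw [funext e]
  exact hΦ.comp_aemeasurable (aemeasurable_pi_lambda _ fun j => (hξ.law j).aemeasurable)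

theorem indepFun_iterate (h : M.Assumptions c) (hξ : M.IsSampling n P ξ) (w₀ : Vec d) (k : ℕ) :
    IndepFun (M.iterate c n w₀ ξ k) (ξ k) P := by
  obtain ⟨Φ, hΦ, e⟩ := h.exists_measurable_iterate w₀ ξ k
  have h1 := hξ.indep.indepFun_finset₀ (Finset.range k) {k} (by simp)
    fun j => (hξ.law j).aemeasurable
  have h2 := h1.comp hΦ (measurable_pi_apply (⟨k, Finset.mem_singleton_self k⟩ : ({k} : Finset ℕ)))
  rw [funext e]
  exact h2

variable [IsProbabilityMeasure P]

/-- By independence the joint law of iterate and fresh sample is a product, and Tonelli replaces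
conditioning on the past. Values in `[0, ∞]` avoid any integrability question. -/
theorem lintegral_iterate_succ (h : M.Assumptions c) (hξ : M.IsSampling n P ξ) (w₀ : Vec d)
    (k : ℕ) {φ : Vec d → ENNReal} (hφ : Measurable φ) :
    ∫⁻ ω, φ (M.iterate c n w₀ ξ (k + 1) ω) ∂P =
      ∫⁻ ω, ∫⁻ x, φ (M.step c n (M.iterate c n w₀ ξ k ω) x) ∂(M.blockLaw n) ∂P := by
  have := h.isProbabilityMeasure_blockLaw (n := n)
  have hw := h.aemeasurable_iterate hξ w₀ k
  have hx := (hξ.law k).aemeasurable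
  have hmap := (indepFun_iff_map_prod_eq_prod_map_map hw hx).1 (h.indepFun_iterate hξ w₀ k)
  rw [(hξ.law k).map_eq] at hmap
  have hm : Measurable fun y : Vec d × Block ι Θ n => φ (M.step c n y.1 y.2) :=
    hφ.comp h.measurable_step
  have e : ∫⁻ ω, φ (M.iterate c n w₀ ξ (k + 1) ω) ∂P =
      ∫⁻ y, φ (M.step c n y.1 y.2) ∂(P.map fun ω => (M.iterate c n w₀ ξ k ω, ξ k ω)) := by
    rw [lintegral_map' hm.aemeasurable (hw.prodMk hx)]
    rfl
  rw [e, hmap, lintegral_prod _ hm.aemeasurable, lintegral_map' hm.lintegral_prod_right'.aemeasurable hw]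

theorem progress_nonneg (h : M.Assumptions c) (hα : 0 < c.α) (w : Vec d) :
    0 ≤ M.progress c w := by
  have := h.L_pos
  have := h.ρ_nonneg
  have := h.σ_pos
  unfold progress
  positivity

theorem measurable_progress (h : M.Assumptions c) (hα : 0 < c.α) (hαL : c.α * c.L ≤ 1 / 6) :
    Measurable (M.progress c) := by
  have h1 : Measurable fun w => ‖gradient (M.F c.α) w‖ :=
    (h.continuous_gradient_F hα hαL).norm.measurable
  exact (h1.pow_const 2).div (((h1.const_add _).const_mul _).const_add _ |>.const_mul _)

theorem lintegral_step_add_progress_le (h : M.Assumptions c) (hα : 0 < c.α)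
    (hαL : c.α * c.L ≤ 1 / 6) (hn : n.Admissible c) (w : Vec d) :
    ∫⁻ x, ENNReal.ofReal (M.F c.α (M.step c n w x) - ⨅ u, M.F c.α u) ∂(M.blockLaw n) +
        ENNReal.ofReal (M.progress c w) ≤
      ENNReal.ofReal (M.F c.α w - ⨅ u, M.F c.α u) +
        ENNReal.ofReal (11 / 400 * (noiseLevel c n / c.L)) := by
  have := h.isProbabilityMeasure_blockLaw (n := n)
  have hi := (h.integrable_F_step hα hαL hn w).1
  have hF : ∀ u, 0 ≤ M.F c.α u - ⨅ u, M.F c.α u := fun u => sub_nonneg.2 (ciInf_le h.bddBelow u)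
  have hL := h.L_pos
  have hs := noiseLevel_nonneg (c := c) (n := n)
  have hi' : Integrable (fun x => M.F c.α (M.step c n w x) - ⨅ u, M.F c.α u) (M.blockLaw n) :=
    hi.sub (integrable_const _)
  rw [← ofReal_integral_eq_lintegral_ofReal hi' (Filter.Eventually.of_forall fun x => hF _),
    ← ENNReal.ofReal_add (integral_nonneg fun x => hF _) (h.progress_nonneg hα w),
    ← ENNReal.ofReal_add (hF _) (by positivity)]
  refine ENNReal.ofReal_le_ofReal ?_
  rw [integral_sub hi (integrable_const _)]
  have := h.integral_F_step_add_progress_le hα hαL hn w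
  simp only [integral_const, probReal_univ, one_smul]
  linarith

/-- The expected decrease of the objective along the iterates. -/
theorem exists_descent (h : M.Assumptions c) (hα : 0 < c.α)
    (hαL : c.α * c.L ≤ 1 / 6) (hn : n.Admissible c) (hξ : M.IsSampling n P ξ) (w₀ : Vec d) :
    (∀ k, Integrable (fun ω => M.progress c (M.iterate c n w₀ ξ k ω)) P) ∧
    ∃ e : ℕ → ℝ, e 0 = M.gap c.α w₀ ∧ (∀ k, 0 ≤ e k) ∧
      ∀ k, e (k + 1) + ∫ ω, M.progress c (M.iterate c n w₀ ξ k ω) ∂P ≤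
        e k + 11 / 400 * (noiseLevel c n / c.L) := by
  set κ := 11 / 400 * (noiseLevel c n / c.L)
  -- Integrability of `F(w_k)` is not known in advance. The gap and the progress are therefore
  -- summed in `[0, ∞]`.
  let U : Vec d → ENNReal := fun w => ENNReal.ofReal (M.F c.α w - ⨅ u, M.F c.α u)
  let E : ℕ → ENNReal := fun k => ∫⁻ ω, U (M.iterate c n w₀ ξ k ω) ∂P
  let Q : ℕ → ENNReal := fun k => ∫⁻ ω, ENNReal.ofReal (M.progress c (M.iterate c n w₀ ξ k ω)) ∂P
  have hU : Measurable U :=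
    ((h.differentiable_F hα hαL).continuous.measurable.sub_const _).ennreal_ofReal
  have hpm := h.measurable_progress hα hαL
  have hpi : ∀ k, AEMeasurable (fun ω => M.progress c (M.iterate c n w₀ ξ k ω)) P := fun k =>
    hpm.comp_aemeasurable (h.aemeasurable_iterate hξ w₀ k)
  have h0 : E 0 = ENNReal.ofReal (M.gap c.α w₀) := by
    simp only [E, iterate, lintegral_const, measure_univ, mul_one]
    rfl
  have hstep : ∀ k, E (k + 1) + Q k ≤ E k + ENNReal.ofReal κ := by
    intro k
    change ∫⁻ ω, U (M.iterate c n w₀ ξ (k + 1) ω) ∂P + Q k ≤ _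
    rw [h.lintegral_iterate_succ hξ w₀ k hU, ← lintegral_add_right' _ (hpi k).ennreal_ofReal]
    refine (lintegral_mono fun ω => h.lintegral_step_add_progress_le hα hαL hn _).trans ?_
    rw [lintegral_add_right _ measurable_const]
    simp only [lintegral_const, measure_univ, mul_one]
    rfl
  -- Finiteness propagates from the deterministic starting point through the descent inequality, and
  -- the same inequality then bounds `Q`.
  have hE : ∀ k, E k ≠ ⊤ := by
    intro k
    induction k with
    | zero => rw [h0]; exact ENNReal.ofReal_ne_top
    | succ k ih =>
      exact ne_top_of_le_ne_top (ENNReal.add_ne_top.2 ⟨ih, ENNReal.ofReal_ne_top⟩)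
        (le_self_add.trans (hstep k))
  have hQ : ∀ k, Q k ≠ ⊤ := fun k =>
    ne_top_of_le_ne_top (ENNReal.add_ne_top.2 ⟨hE k, ENNReal.ofReal_ne_top⟩)
      (le_add_self.trans (hstep k))
  have hQr : ∀ k, ∫ ω, M.progress c (M.iterate c n w₀ ξ k ω) ∂P = (Q k).toReal := fun k =>
    integral_eq_lintegral_of_nonneg_ae (Filter.Eventually.of_forall fun ω => h.progress_nonneg hα _)
      (hpi k).aestronglyMeasurable
  have hgap : 0 ≤ M.gap c.α w₀ := sub_nonneg.2 (ciInf_le h.bddBelow w₀)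
  have hκ : 0 ≤ κ := by
    have := h.L_pos
    have := noiseLevel_nonneg (c := c) (n := n)
    positivity
  refine ⟨fun k => ⟨(hpi k).aestronglyMeasurable, ?_⟩, fun k => (E k).toReal, ?_,
    fun k => ENNReal.toReal_nonneg, fun k => ?_⟩
  · rw [hasFiniteIntegral_iff_ofReal (Filter.Eventually.of_forall fun ω => h.progress_nonneg hα _)]
    exact (hQ k).lt_top
  · simp only [h0, ENNReal.toReal_ofReal hgap]
  · rw [hQr, ← ENNReal.toReal_add (hE _) (hQ _), ← ENNReal.toReal_ofReal hκ,
      ← ENNReal.toReal_add (hE _) ENNReal.ofReal_ne_top]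
    exact ENNReal.toReal_mono (ENNReal.add_ne_top.2 ⟨hE k, ENNReal.ofReal_ne_top⟩) (hstep k)

theorem tangent_le_progress (h : M.Assumptions c) (hα : 0 < c.α) (w : Vec d) (t : ℝ) :
    ‖gradient (M.F c.α) w‖ * (2 * t - t ^ 2 * (c.ρ * c.α)) - t ^ 2 * (c.L + c.ρ * c.α * c.σ) ≤
      240 * M.progress c w := by
  have := h.L_pos
  have := h.ρ_nonneg
  have := h.σ_pos
  refine (tangent_le_sq_div (by positivity)).trans_eq ?_
  unfold progress
  rw [mul_div_assoc', mul_div_mul_left _ _ (by norm_num)]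
  ring_nf

/-- A tangent line with positive slope bounds the gradient norm by an affine function of the
integrable `progress`; `t = 1/(ρα + 1)` ensures `t ρα ≤ 1`, hence such a slope. -/
theorem integrable_norm_gradient_iterate (h : M.Assumptions c) (hα : 0 < c.α)
    (hαL : c.α * c.L ≤ 1 / 6) (hn : n.Admissible c) (hξ : M.IsSampling n P ξ) (w₀ : Vec d)
    (k : ℕ) : Integrable (fun ω => ‖gradient (M.F c.α) (M.iterate c n w₀ ξ k ω)‖) P := by
  have hp := (h.exists_descent hα hαL hn hξ w₀).1 k
  have hρ := h.ρ_nonneg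
  set t : ℝ := 1 / (c.ρ * c.α + 1)
  have ht : 0 < t := by positivity
  have hden : 0 < 2 * t - t ^ 2 * (c.ρ * c.α) := by
    have : t * (c.ρ * c.α) ≤ 1 := by
      simp only [t]
      rw [div_mul_eq_mul_div, one_mul, div_le_one (by positivity)]
      linarith
    nlinarith
  refine (((hp.const_mul 240).add (integrable_const (t ^ 2 * (c.L + c.ρ * c.α * c.σ)))).div_const
    (2 * t - t ^ 2 * (c.ρ * c.α))).mono' ?_ (Filter.Eventually.of_forall fun ω => ?_)
  · exact ((h.continuous_gradient_F hα hαL).norm.measurable.comp_aemeasurable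
      (h.aemeasurable_iterate hξ w₀ k)).aestronglyMeasurable
  · rw [norm_norm, le_div_iff₀ hden]
    have := h.tangent_le_progress hα (M.iterate c n w₀ ξ k ω) t
    simp only [Pi.add_apply]
    linarith

/-- Jensen's inequality for `x ↦ x²/(A + b x)`, obtained by integrating its tangent line at `m`. The
slope is nonnegative, so the mean gradient norm may be replaced by its lower bound `m`. -/
theorem sq_div_le_integral_progress (h : M.Assumptions c) (hα : 0 < c.α)
    (hαL : c.α * c.L ≤ 1 / 6) (hn : n.Admissible c) (hξ : M.IsSampling n P ξ) (w₀ : Vec d)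
    (k : ℕ) {m : ℝ} (hm : 0 < m)
    (hk : m ≤ ∫ ω, ‖gradient (M.F c.α) (M.iterate c n w₀ ξ k ω)‖ ∂P) :
    m ^ 2 / (c.L + c.ρ * c.α * (c.σ + m)) ≤
      240 * ∫ ω, M.progress c (M.iterate c n w₀ ξ k ω) ∂P := by
  have hp := (h.exists_descent hα hαL hn hξ w₀).1 k
  have hD := h.integrable_norm_gradient_iterate hα hαL hn hξ w₀ k
  have hρ := h.ρ_nonneg
  have hL := h.L_pos
  have hσ := h.σ_pos
  set A := c.L + c.ρ * c.α * c.σ with hA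
  set b := c.ρ * c.α with hb
  have hb0 : 0 ≤ b := by positivity
  have hA0 : 0 < A := by positivity
  have hden : c.L + b * (c.σ + m) = A + b * m := by rw [hA]; ring
  rw [hden]
  -- This `t` makes the tangent line touch the function at `x = m`.
  set t := m / (A + b * m) with ht
  have hAm : 0 < A + b * m := by positivity
  have ht0 : 0 < t := by positivity
  have htb : t * b ≤ 1 := by
    rw [ht, div_mul_eq_mul_div, div_le_one hAm]
    linarith
  have h1 : (∫ ω, ‖gradient (M.F c.α) (M.iterate c n w₀ ξ k ω)‖ ∂P) * (2 * t - t ^ 2 * b) -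
      t ^ 2 * A ≤ 240 * ∫ ω, M.progress c (M.iterate c n w₀ ξ k ω) ∂P := by
    rw [← integral_mul_const, ← integral_const_mul]
    have : t ^ 2 * A = ∫ _, t ^ 2 * A ∂P := by simp
    rw [this, ← integral_sub (hD.mul_const _) (integrable_const _)]
    exact integral_mono ((hD.mul_const _).sub (integrable_const _)) (hp.const_mul _)
      fun ω => h.tangent_le_progress hα _ t
  have h2 : m * (2 * t - t ^ 2 * b) - t ^ 2 * A = m ^ 2 / (A + b * m) := by
    rw [ht]
    field_simp
    ring
  have h3 : 0 ≤ 2 * t - t ^ 2 * b := by nlinarith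
  have h4 := mul_le_mul_of_nonneg_right hk h3
  linarith

/-- The number of iterations until the expected gradient norm is at most `m`, for any `m` above the
noise floor. -/
theorem exists_iterate_le (h : M.Assumptions c) (hα : 0 < c.α)
    (hαL : c.α * c.L ≤ 1 / 6) (hn : n.Admissible c) (hξ : M.IsSampling n P ξ) (w₀ : Vec d)
    {m : ℝ} (hm : 0 < m)
    (hnoise : 61 / 2 * (noiseLevel c n / c.L) ≤ m ^ 2 / (c.L + c.ρ * c.α * (c.σ + m))) :
    ∃ k : ℕ, (k : ℝ) * (m ^ 2 / (c.L + c.ρ * c.α * (c.σ + m))) ≤ 480 * M.gap c.α w₀ ∧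
      ∫ ω, ‖gradient (M.F c.α) (M.iterate c n w₀ ξ k ω)‖ ∂P ≤ m := by
  obtain ⟨-, e, he0, he, hstep⟩ := h.exists_descent hα hαL hn hξ w₀
  set φ := m ^ 2 / (c.L + c.ρ * c.α * (c.σ + m)) with hφ
  have hφ0 : 0 < φ := by
    have := h.ρ_nonneg
    have := h.L_pos
    have := h.σ_pos
    positivity
  -- While the target is missed, an iteration gains `φ/240` and loses at most `11/400 · 2/61 · φ <
  -- φ/480` to noise, a net decrease of at least `φ/480`. Since `e` stays nonnegative, the first
  -- successful index is bounded.
  have key : ∀ N : ℕ, (∀ k < N, m < ∫ ω, ‖gradient (M.F c.α) (M.iterate c n w₀ ξ k ω)‖ ∂P) →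
      e N + N * (φ / 480) ≤ M.gap c.α w₀ := by
    intro N
    induction N with
    | zero => intro _; simp [he0]
    | succ N ih =>
      intro hN
      have h1 := ih fun k hk => hN k (Nat.lt_succ_of_lt hk)
      have h2 := hstep N
      have h3 := h.sq_div_le_integral_progress hα hαL hn hξ w₀ N hm (hN N (Nat.lt_succ_self N)).le
      rw [← hφ] at h3
      push_cast
      linarith
  have hex : ∃ k, ∫ ω, ‖gradient (M.F c.α) (M.iterate c n w₀ ξ k ω)‖ ∂P ≤ m := by
    by_contra! hcon
    obtain ⟨N, hN⟩ := exists_nat_gt (M.gap c.α w₀ / (φ / 480))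
    rw [div_lt_iff₀ (by positivity)] at hN
    have := key N fun k _ => hcon k
    linarith [he N]
  classical
  refine ⟨Nat.find hex, ?_, Nat.find_spec hex⟩
  have := key (Nat.find hex) fun k hk => lt_of_not_ge (Nat.find_min hex hk)
  linarith [he (Nat.find hex)]

end Assumptions
end Model
end MAML
end

/-! ### Choice of the accuracy level and the final constants. -/

noncomputable section
namespace MAML
namespace Model
namespace Assumptions

variable {d : ℕ} {ι : Type u} {Θ : Type v} [MeasurableSpace ι] [MeasurableSpace Θ]
  [Countable ι] [DiscreteMeasurableSpace ι] {M : Model d ι Θ} {c : Constants} {n : BatchSizes}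
  {Ω : Type w} [MeasurableSpace Ω] {P : Measure Ω} [IsProbabilityMeasure P]
  {ξ : ℕ → Ω → Block ι Θ n}

theorem mul_L_le (h : M.Assumptions c) (hαL : c.α ≤ 1 / (6 * c.L)) : c.α * c.L ≤ 1 / 6 := by
  have hL := h.L_pos
  rw [le_div_iff₀ (by positivity)] at hαL
  linarith

theorem gap_nonneg (h : M.Assumptions c) (w₀ : Vec d) : 0 ≤ M.gap c.α w₀ :=
  sub_nonneg.2 (ciInf_le h.bddBelow w₀)

/-- The denominator is `L (1 + bσ/L) + b m`. The first entry of the maximum handles the first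
summand and the second entry, multiplied by `m`, the other; each accounts for half of `m²`, whence
`61/2` out of `61`. -/
theorem noise_le_sq_div {L b σ s m : ℝ} (hL : 0 < L) (hb : 0 ≤ b) (hσ : 0 < σ)
    (hm : 0 < m) (h1 : Real.sqrt (61 * (1 + b / L * σ) * s) ≤ m) (h2 : 61 * b / L * s ≤ m) :
    61 / 2 * (s / L) ≤ m ^ 2 / (L + b * (σ + m)) := by
  have h3 : 61 * (1 + b / L * σ) * s ≤ m ^ 2 := (Real.sqrt_le_left hm.le).1 h1
  have h4 := mul_le_mul_of_nonneg_right h2 hm.le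
  rw [le_div_iff₀ (by positivity)]
  have e : 61 / 2 * (s / L) * (L + b * (σ + m)) =
      1 / 2 * (61 * (1 + b / L * σ) * s) + 1 / 2 * (61 * b / L * s * m) := by
    field_simp
    ring
  rw [e]
  nlinarith

/-- One index `k` serves both bounds, because `φ(m)` has two lower bounds: `φ(ε)` by monotonicity,
and the noise floor, of which the summand `σ²/B` alone suffices. The second bound is thus stronger
than the one in the theorem. -/
theorem exists_iterate_le_max (h : M.Assumptions c) (hα : 0 < c.α)
    (hαL : c.α * c.L ≤ 1 / 6) (hn : n.Admissible c) (hξ : M.IsSampling n P ξ) (w₀ : Vec d)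
    {ε : ℝ} (hε : 0 < ε) :
    ∃ k : ℕ,
      (k : ℝ) ≤ 480 * M.gap c.α w₀ * ((c.L + c.ρ * c.α * (c.σ + ε)) / ε ^ 2) ∧
      (k : ℝ) ≤ 480 * M.gap c.α w₀ * (c.L * n.B / c.σ ^ 2) ∧
      ∫ ω, ‖gradient (M.F c.α) (M.iterate c n w₀ ξ k ω)‖ ∂P ≤
        max (max (Real.sqrt (61 * (1 + c.ρ * c.α / c.L * c.σ) * noiseLevel c n))
          (61 * (c.ρ * c.α) / c.L * noiseLevel c n)) ε := by
  have hL := h.L_pos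
  have hρ := h.ρ_nonneg
  have hσ := h.σ_pos
  have hb : 0 ≤ c.ρ * c.α := by positivity
  have hs := noiseLevel_nonneg (c := c) (n := n)
  have hΔ := h.gap_nonneg w₀
  have hB : (0 : ℝ) < n.B := by
    have : (20 : ℝ) ≤ n.B := by exact_mod_cast hn.B_ge
    linarith
  set m := max (max (Real.sqrt (61 * (1 + c.ρ * c.α / c.L * c.σ) * noiseLevel c n))
    (61 * (c.ρ * c.α) / c.L * noiseLevel c n)) ε
  have hεm : ε ≤ m := le_max_right _ _
  have hm : 0 < m := hε.trans_le hεm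
  have hnoise := noise_le_sq_div hL hb hσ hm ((le_max_left _ _).trans (le_max_left _ _))
    ((le_max_right _ _).trans (le_max_left _ _))
  obtain ⟨k, hk, hkm⟩ := h.exists_iterate_le hα hαL hn hξ w₀ hm hnoise
  have hk0 : (0 : ℝ) ≤ k := k.cast_nonneg
  refine ⟨k, ?_, ?_, hkm⟩
  · have h1 := sq_div_mono (A := c.L + c.ρ * c.α * c.σ) (by positivity) hb hε.le hεm
    have h2 : (k : ℝ) * (ε ^ 2 / (c.L + c.ρ * c.α * (c.σ + ε))) ≤ 480 * M.gap c.α w₀ := by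
      refine le_trans (mul_le_mul_of_nonneg_left ?_ hk0) hk
      rwa [mul_add, mul_add, ← add_assoc, ← add_assoc]
    have hpos : 0 < ε ^ 2 / (c.L + c.ρ * c.α * (c.σ + ε)) := by positivity
    rw [← le_div_iff₀ hpos] at h2
    refine h2.trans_eq ?_
    rw [div_div_eq_mul_div, mul_div_assoc]
  · have h1 : c.σ ^ 2 / n.B / c.L ≤ 61 / 2 * (noiseLevel c n / c.L) := by
      have h2 : c.σ ^ 2 / n.B ≤ noiseLevel c n := by
        have : 0 ≤ c.σt ^ 2 / (n.B * n.Do) + c.σt ^ 2 / n.Din := by positivity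
        unfold noiseLevel
        linarith
      have h3 : c.σ ^ 2 / n.B / c.L ≤ noiseLevel c n / c.L := by gcongr
      have : 0 ≤ noiseLevel c n / c.L := by positivity
      linarith
    have h2 := (mul_le_mul_of_nonneg_left (h1.trans hnoise) hk0).trans hk
    have hpos : 0 < c.σ ^ 2 / n.B / c.L := by positivity
    rw [← le_div_iff₀ hpos] at h2
    refine h2.trans_eq ?_
    field_simp

/-- Boundedness of `s` turns the linear term into one of order `√s`, since `√s ≤ 2K + 1`. Under the
square root, a constant that is at least `1` is replaced by its square. -/
theorem max_le_mul_sqrt_add {K L b σ s ε : ℝ} (hL : 0 < L) (hb : 0 ≤ b) (hσ : 0 < σ) (hs : 0 ≤ s)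
    (hbK : b / L ≤ K) (hσK : σ ^ 2 ≤ K) (hsK : s ≤ 2 * K) (hε : 0 < ε) :
    max (max (Real.sqrt (61 * (1 + b / L * σ) * s)) (61 * b / L * s)) ε ≤
      (61 * (1 + K * (K + 1)) + 61 * K * (2 * K + 1)) * Real.sqrt s + ε := by
  have hK : 0 ≤ K := (by positivity : 0 ≤ b / L).trans hbK
  have hσ' : σ ≤ K + 1 := by nlinarith
  have hr := Real.sqrt_nonneg s
  have hr2 := Real.sq_sqrt hs
  set r := Real.sqrt s
  have hrK : r ≤ 2 * K + 1 := by nlinarith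
  have e1 : Real.sqrt (61 * (1 + b / L * σ) * s) ≤ 61 * (1 + K * (K + 1)) * r := by
    rw [Real.sqrt_le_left (by positivity), mul_pow, hr2]
    have h1 : b / L * σ ≤ K * (K + 1) := by gcongr
    have h2 : 61 * (1 + b / L * σ) ≤ 61 * (1 + K * (K + 1)) := by linarith
    have h3 : (1 : ℝ) ≤ 61 * (1 + K * (K + 1)) := by nlinarith
    have h4 : 61 * (1 + K * (K + 1)) ≤ (61 * (1 + K * (K + 1))) ^ 2 := by nlinarith
    exact mul_le_mul_of_nonneg_right (h2.trans h4) hs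
  have e2 : 61 * b / L * s ≤ 61 * K * (2 * K + 1) * r := by
    have h1 : s ≤ (2 * K + 1) * r := by nlinarith
    calc 61 * b / L * s = 61 * (b / L) * s := by ring
      _ ≤ 61 * K * ((2 * K + 1) * r) := by gcongr
      _ = _ := by ring
  have p1 : 0 ≤ 61 * (1 + K * (K + 1)) * r := by positivity
  have p2 : 0 ≤ 61 * K * (2 * K + 1) * r := by positivity
  refine max_le (max_le ?_ ?_) ?_ <;> linarith

theorem noiseLevel_le (hn : n.Admissible c) : noiseLevel c n ≤ 2 * (c.σ ^ 2 + c.σt ^ 2) := by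
  have hB : (20 : ℝ) ≤ n.B := by exact_mod_cast hn.B_ge
  have hDo : (1 : ℝ) ≤ n.Do := by exact_mod_cast hn.Do_pos
  have hDin : (1 : ℝ) ≤ n.Din := by exact_mod_cast hn.Din_pos
  have h1 : c.σ ^ 2 / n.B ≤ c.σ ^ 2 := div_le_self (sq_nonneg _) (by linarith)
  have h2 : c.σt ^ 2 / (n.B * n.Do) ≤ c.σt ^ 2 := div_le_self (sq_nonneg _) (by nlinarith)
  have h3 : c.σt ^ 2 / n.Din ≤ c.σt ^ 2 := div_le_self (sq_nonneg _) hDin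
  unfold noiseLevel
  nlinarith [sq_nonneg c.σ]

end Assumptions
end Model
end MAML
end

theorem theorem2 :
    -- general version
    (∃ C : ℝ, 0 < C ∧
      ∀ (d : ℕ) (ι : Type u) (Θ : Type v) (Ω : Type w)
        [MeasurableSpace ι] [Countable ι] [DiscreteMeasurableSpace ι] [MeasurableSpace Θ]
        [MeasurableSpace Ω] (P : Measure Ω) [IsProbabilityMeasure P]
        (M : MAML.Model d ι Θ) (c : MAML.Constants) (n : MAML.BatchSizes) (w₀ : MAML.Vec d)
        (ξ : ℕ → Ω → MAML.Block ι Θ n),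
        M.Assumptions c → 0 < c.α → c.α ≤ 1 / (6 * c.L) → n.Admissible c →
        M.IsSampling n P ξ →
        Differentiable ℝ (M.F c.α) ∧
        ∀ ε : ℝ, 0 < ε →
          ∃ k : ℕ,
            (k : ℝ) ≤ C * M.gap c.α w₀ * ((c.L + c.ρ * c.α * (c.σ + ε)) / ε ^ 2) ∧
            (0 < c.σt → (k : ℝ) ≤ C * M.gap c.α w₀ *
              (c.L * n.B / c.σ ^ 2 + c.L * (n.B * n.Do + n.Din) / c.σt ^ 2)) ∧
            Integrable (fun ω => ‖gradient (M.F c.α) (M.iterate c n w₀ ξ k ω)‖) P ∧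
            ∫ ω, ‖gradient (M.F c.α) (M.iterate c n w₀ ξ k ω)‖ ∂P ≤
              max (max
                (Real.sqrt (61 * (1 + c.ρ * c.α / c.L * c.σ) * MAML.noiseLevel c n))
                (61 * (c.ρ * c.α) / c.L * MAML.noiseLevel c n)) ε) ∧
    -- simplified version: `ρ α / L` and `σ² + σt²` are bounded by a constant `K`
    (∀ K : ℝ, ∃ C : ℝ, 0 < C ∧
      ∀ (d : ℕ) (ι : Type u) (Θ : Type v) (Ω : Type w)
        [MeasurableSpace ι] [Countable ι] [DiscreteMeasurableSpace ι] [MeasurableSpace Θ]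
        [MeasurableSpace Ω] (P : Measure Ω) [IsProbabilityMeasure P]
        (M : MAML.Model d ι Θ) (c : MAML.Constants) (n : MAML.BatchSizes) (w₀ : MAML.Vec d)
        (ξ : ℕ → Ω → MAML.Block ι Θ n),
        M.Assumptions c → 0 < c.α → c.α ≤ 1 / (6 * c.L) → n.Admissible c →
        M.IsSampling n P ξ →
        c.ρ * c.α / c.L ≤ K → c.σ ^ 2 + c.σt ^ 2 ≤ K →
        ∀ ε : ℝ, 0 < ε → ε < 1 →
          ∃ k : ℕ,
            (k : ℝ) ≤ C * M.gap c.α w₀ * (c.L / ε ^ 2) ∧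
            (0 < c.σt → (k : ℝ) ≤ C * M.gap c.α w₀ *
              (c.L * n.B / c.σ ^ 2 + c.L * (n.B * n.Do + n.Din) / c.σt ^ 2)) ∧
            Integrable (fun ω => ‖gradient (M.F c.α) (M.iterate c n w₀ ξ k ω)‖) P ∧
            ∫ ω, ‖gradient (M.F c.α) (M.iterate c n w₀ ξ k ω)‖ ∂P ≤
              C * Real.sqrt (MAML.noiseLevel c n) + ε) := by
  constructor
  · refine ⟨480, by norm_num, ?_⟩
    intro d ι Θ Ω _ _ _ _ _ P _ M c n w₀ ξ h hα hαL hn hξ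
    have hαL' := h.mul_L_le hαL
    refine ⟨h.differentiable_F hα hαL', fun ε hε => ?_⟩
    obtain ⟨k, h1, h2, h3⟩ := h.exists_iterate_le_max hα hαL' hn hξ w₀ hε
    refine ⟨k, h1, fun _ => h2.trans ?_, h.integrable_norm_gradient_iterate hα hαL' hn hξ w₀ k, h3⟩
    have hΔ := h.gap_nonneg w₀
    have hL := h.L_pos
    have : 0 ≤ c.L * (n.B * n.Do + n.Din) / c.σt ^ 2 := by positivity
    gcongr
    linarith
  · intro K
    -- The first summand serves the iteration bounds (with `σ + ε ≤ K + 2`), the second the accuracy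
    -- from `max_le_mul_sqrt_add`. The absolute value keeps the constant positive for every real
    -- `K`; the hypotheses on the problem then force `K ≥ 0`.
    refine ⟨480 * (1 + |K| * (|K| + 2)) + (61 * (1 + |K| * (|K| + 1)) + 61 * |K| * (2 * |K| + 1)),
      by positivity, ?_⟩
    intro d ι Θ Ω _ _ _ _ _ P _ M c n w₀ ξ h hα hαL hn hξ hρK hσK ε hε hε1
    have hαL' := h.mul_L_le hαL
    have hΔ := h.gap_nonneg w₀
    have hL := h.L_pos
    have hρ := h.ρ_nonneg
    have hσ := h.σ_pos
    have hs := MAML.Model.Assumptions.noiseLevel_nonneg (c := c) (n := n)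
    have hK : 0 ≤ K := (by positivity : 0 ≤ c.ρ * c.α / c.L).trans hρK
    rw [abs_of_nonneg hK]
    have hσK' : c.σ ^ 2 ≤ K := by nlinarith [sq_nonneg c.σt]
    have hsK : MAML.noiseLevel c n ≤ 2 * K :=
      (MAML.Model.Assumptions.noiseLevel_le hn).trans (by linarith)
    obtain ⟨k, h1, h2, h3⟩ := h.exists_iterate_le_max hα hαL' hn hξ w₀ hε
    have hC1 : 480 * (1 + K * (K + 2)) ≤
        480 * (1 + K * (K + 2)) + (61 * (1 + K * (K + 1)) + 61 * K * (2 * K + 1)) :=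
      le_add_of_nonneg_right (by positivity)
    have hC2 : 61 * (1 + K * (K + 1)) + 61 * K * (2 * K + 1) ≤
        480 * (1 + K * (K + 2)) + (61 * (1 + K * (K + 1)) + 61 * K * (2 * K + 1)) :=
      le_add_of_nonneg_left (by positivity)
    set C := 480 * (1 + K * (K + 2)) + (61 * (1 + K * (K + 1)) + 61 * K * (2 * K + 1))
    refine ⟨k, h1.trans ?_, fun _ => h2.trans ?_,
      h.integrable_norm_gradient_iterate hα hαL' hn hξ w₀ k, h3.trans ?_⟩
    · have hσ' : c.σ ≤ K + 1 := by nlinarith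
      have hρL : c.ρ * c.α ≤ K * c.L := (div_le_iff₀ hL).1 hρK
      have h4 : c.L + c.ρ * c.α * (c.σ + ε) ≤ (1 + K * (K + 2)) * c.L := by
        have : c.ρ * c.α * (c.σ + ε) ≤ K * c.L * (K + 2) := by
          exact mul_le_mul hρL (by linarith) (by positivity) (by positivity)
        linarith
      calc 480 * M.gap c.α w₀ * ((c.L + c.ρ * c.α * (c.σ + ε)) / ε ^ 2)
          ≤ 480 * M.gap c.α w₀ * ((1 + K * (K + 2)) * c.L / ε ^ 2) := by gcongr
        _ = 480 * (1 + K * (K + 2)) * M.gap c.α w₀ * (c.L / ε ^ 2) := by ring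
        _ ≤ _ := by gcongr
    · have h480 : (480 : ℝ) ≤ C := by
        refine le_trans ?_ hC1
        nlinarith [mul_nonneg hK hK]
      have : 0 ≤ c.L * (n.B * n.Do + n.Din) / c.σt ^ 2 := by positivity
      gcongr
      linarith
    · refine (MAML.Model.Assumptions.max_le_mul_sqrt_add hL (by positivity) hσ hs hρK hσK' hsK
        hε).trans ?_
      gcongr
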